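/- Let $n\ge 0$ be an integer, let $x_{ij}$ ($1\le i\le j\le n+1$), $y_k$ ($1\le k\le n+1$) and $r$ be independent variables, and put $\partial_{ij}=\partial/\partial x_{ij}$, $\partial_k=\partial/\partial y_k$, $\partial_r=\partial/\partial r$. Let $$D=\mathbb C\langle x_{ij},y_k,r,\partial_{ij},\partial_k,\partial_r\rangle$$ be the Weyl algebra in these variables, $K=\mathbb C(x_{ij},y_k,r)$ the field of rational functions in all of them, and $K\langle\partial\rangle=K\langle\partial_{ij},\partial_k,\partial_r\rangle$ the ring of differential operators with coefficients in $K$. The holonomic rank of a left ideal $J\subseteq D$ is $\operatorname{rank}(J)=\dim_K K\langle\partial\rangle/K\langle\partial\rangle J$. Let $\tilde I$ be the left ideal of $D$ (the diagonal Fisher–Bingham system) generated by $$A_i=\partial_{ii}-\partial_i^2\ (1\le i\le n+1),\qquad B=\sum_{i=1}^{n+1}\partial_i^2-r^2,$$ $$C_{ij}=2(x_{ii}-x_{jj})\partial_i\partial_j+y_i\partial_j-y_j\partial_i\ (1\le i<j\le n+1),$$ $$E=r\partial_r-2\sum_{i=1}^{n+1}x_{ii}\partial_i^2-\sum_{i=1}^{n+1}y_i\partial_i-n,$$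 and $\partial_{ij}$ for $1\le i<j\le n+1$. Theorem. The holonomic rank of $\tilde I$ is $2n+2$. Moreover, the residue classes of the $2n+2$ monomials $1$, $\partial_1$, and $\partial_k,\ \partial_k^2$ for $2\le k\le n+1$, form a basis of the $K$-vector space $K\langle\partial\rangle/K\langle\partial\rangle\tilde I$. -/

import Mathlib

open scoped Cardinal

namespace FisherBingham

noncomputable section

/-! ## The Weyl algebra -/

/-- The defining relations of the Weyl algebra in the variables `x_s`, `s : σ`.
`Sum.inl s` is the generator `x_s`, `Sum.inr s` is the generator `∂_s`. -/
inductive WeylRel (σ : Type) : FreeAlgebra ℂ (σ ⊕ σ) → FreeAlgebra ℂ (σ ⊕ σ) → Prop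
  | x_comm (s t : σ) : WeylRel σ
      (FreeAlgebra.ι ℂ (Sum.inl s) * FreeAlgebra.ι ℂ (Sum.inl t))
      (FreeAlgebra.ι ℂ (Sum.inl t) * FreeAlgebra.ι ℂ (Sum.inl s))
  | d_comm (s t : σ) : WeylRel σ
      (FreeAlgebra.ι ℂ (Sum.inr s) * FreeAlgebra.ι ℂ (Sum.inr t))
      (FreeAlgebra.ι ℂ (Sum.inr t) * FreeAlgebra.ι ℂ (Sum.inr s))
  | d_x_self (s : σ) : WeylRel σ
      (FreeAlgebra.ι ℂ (Sum.inr s) * FreeAlgebra.ι ℂ (Sum.inl s))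
      (FreeAlgebra.ι ℂ (Sum.inl s) * FreeAlgebra.ι ℂ (Sum.inr s) + 1)
  | d_x_of_ne (s t : σ) (h : s ≠ t) : WeylRel σ
      (FreeAlgebra.ι ℂ (Sum.inr s) * FreeAlgebra.ι ℂ (Sum.inl t))
      (FreeAlgebra.ι ℂ (Sum.inl t) * FreeAlgebra.ι ℂ (Sum.inr s))

/-- The Weyl algebra `D = ℂ⟨x_s, ∂_s | s ∈ σ⟩`. -/
def Weyl (σ : Type) : Type := RingQuot (WeylRel σ)

instance (σ : Type) : Ring (Weyl σ) := inferInstanceAs (Ring (RingQuot (WeylRel σ)))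

instance (σ : Type) : Algebra ℂ (Weyl σ) :=
  inferInstanceAs (Algebra ℂ (RingQuot (WeylRel σ)))

/-- The quotient map from the free algebra to the Weyl algebra. -/
def Weyl.mk (σ : Type) : FreeAlgebra ℂ (σ ⊕ σ) →ₐ[ℂ] Weyl σ :=
  RingQuot.mkAlgHom ℂ (WeylRel σ)

/-- The variable `x_s` of the Weyl algebra. -/
def Weyl.x {σ : Type} (s : σ) : Weyl σ :=
  Weyl.mk σ (FreeAlgebra.ι ℂ (Sum.inl s))

/-- The derivation `∂_s = ∂/∂x_s` of the Weyl algebra. -/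
def Weyl.d {σ : Type} (s : σ) : Weyl σ :=
  Weyl.mk σ (FreeAlgebra.ι ℂ (Sum.inr s))

/-! ## Rational functions and their partial derivatives -/

/-- The field `K = ℂ(x_s | s ∈ σ)` of rational functions. -/
abbrev RatFun (σ : Type) : Type := FractionRing (MvPolynomial σ ℂ)

/-- The ring homomorphism `p ↦ p + p_s ε` from polynomials to dual numbers over `K`, where `p_s`
is the partial derivative of `p` with respect to `x_s`. -/
def dualPoly {σ : Type} (s : σ) :
    MvPolynomial σ ℂ →+* TrivSqZeroExt (RatFun σ) (RatFun σ) where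
  toFun p := TrivSqZeroExt.inl (algebraMap _ (RatFun σ) p) +
    TrivSqZeroExt.inr (algebraMap _ (RatFun σ) (MvPolynomial.pderiv s p))
  map_one' := by ext <;> simp
  map_zero' := by ext <;> simp
  map_add' p q := by ext <;> simp [Algebra.smul_def]
  map_mul' p q := by
    ext
    · simp
    · simp only [Derivation.leibniz, TrivSqZeroExt.snd_add, TrivSqZeroExt.snd_inl,
        TrivSqZeroExt.snd_inr, TrivSqZeroExt.snd_mul, TrivSqZeroExt.fst_add,
        TrivSqZeroExt.fst_inl, TrivSqZeroExt.fst_inr, map_add, map_mul, smul_eq_mul,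
        MulOpposite.smul_eq_mul_unop, MulOpposite.unop_op]
      ring

theorem isUnit_dualPoly {σ : Type} (s : σ) (p : nonZeroDivisors (MvPolynomial σ ℂ)) :
    IsUnit (dualPoly s p) := by
  rw [TrivSqZeroExt.isUnit_iff_isUnit_fst]
  simp [dualPoly]

/-- The extension of `dualPoly` to rational functions, `f ↦ f + f_s ε`. -/
def dualRat {σ : Type} (s : σ) : RatFun σ →+* TrivSqZeroExt (RatFun σ) (RatFun σ) :=
  IsLocalization.lift (isUnit_dualPoly s)

theorem dualRat_algebraMap {σ : Type} (s : σ) (p : MvPolynomial σ ℂ) :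
    dualRat s (algebraMap _ (RatFun σ) p) = dualPoly s p :=
  IsLocalization.lift_eq _ _

theorem fst_dualRat {σ : Type} (s : σ) (f : RatFun σ) : (dualRat s f).fst = f := by
  have h : (TrivSqZeroExt.fstHom ℂ (RatFun σ) (RatFun σ)).toRingHom.comp (dualRat s) =
      RingHom.id (RatFun σ) := by
    apply IsLocalization.ringHom_ext (nonZeroDivisors (MvPolynomial σ ℂ))
    apply RingHom.ext
    intro p
    simp [dualRat_algebraMap, dualPoly]
  exact congrArg (fun g : RatFun σ →+* RatFun σ => g f) h

/-- The partial derivative `∂/∂x_s : K → K`. -/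
def ratDeriv {σ : Type} (s : σ) : Derivation ℂ (RatFun σ) (RatFun σ) :=
  Derivation.mk'
    { toFun := fun f => (dualRat s f).snd
      map_add' := fun f g => by simp
      map_smul' := fun c f => by
        have h : dualRat s (algebraMap ℂ (RatFun σ) c) =
            TrivSqZeroExt.inl (algebraMap ℂ (RatFun σ) c) := by
          rw [IsScalarTower.algebraMap_apply ℂ (MvPolynomial σ ℂ) (RatFun σ),
            dualRat_algebraMap]
          ext <;> simp [dualPoly, MvPolynomial.algebraMap_eq]
        simp [Algebra.smul_def, h] }
    (fun f g => by simp [fst_dualRat, mul_comm])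

/-- On polynomials, `ratDeriv` is the usual partial derivative. -/
theorem ratDeriv_algebraMap {σ : Type} (s : σ) (p : MvPolynomial σ ℂ) :
    ratDeriv s (algebraMap _ (RatFun σ) p) =
      algebraMap _ (RatFun σ) (MvPolynomial.pderiv s p) := by
  change (dualRat s (algebraMap _ (RatFun σ) p)).snd = _
  rw [dualRat_algebraMap]
  change (TrivSqZeroExt.inl _ + TrivSqZeroExt.inr _ :
    TrivSqZeroExt (RatFun σ) (RatFun σ)).snd = _
  rw [TrivSqZeroExt.snd_add, TrivSqZeroExt.snd_inl, TrivSqZeroExt.snd_inr, zero_add]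

/-! ## Differential operators with rational function coefficients -/

/-- The defining relations of the ring `K⟨∂_s | s ∈ σ⟩` of differential operators with
coefficients in `K`. `Sum.inl a` is the coefficient `a ∈ K`, `Sum.inr s` is `∂_s`. The first three
relations say that `K` maps to this ring by a homomorphism of `ℂ`-algebras. -/
inductive DiffOpRel (σ : Type) :
    FreeAlgebra ℂ (RatFun σ ⊕ σ) → FreeAlgebra ℂ (RatFun σ ⊕ σ) → Prop
  | scalar (c : ℂ) : DiffOpRel σ
      (FreeAlgebra.ι ℂ (Sum.inl (algebraMap ℂ (RatFun σ) c)))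
      (algebraMap ℂ (FreeAlgebra ℂ (RatFun σ ⊕ σ)) c)
  | add (a b : RatFun σ) : DiffOpRel σ
      (FreeAlgebra.ι ℂ (Sum.inl (a + b)))
      (FreeAlgebra.ι ℂ (Sum.inl a) + FreeAlgebra.ι ℂ (Sum.inl b))
  | mul (a b : RatFun σ) : DiffOpRel σ
      (FreeAlgebra.ι ℂ (Sum.inl (a * b)))
      (FreeAlgebra.ι ℂ (Sum.inl a) * FreeAlgebra.ι ℂ (Sum.inl b))
  | d_comm (s t : σ) : DiffOpRel σ
      (FreeAlgebra.ι ℂ (Sum.inr s) * FreeAlgebra.ι ℂ (Sum.inr t))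
      (FreeAlgebra.ι ℂ (Sum.inr t) * FreeAlgebra.ι ℂ (Sum.inr s))
  | leibniz (s : σ) (a : RatFun σ) : DiffOpRel σ
      (FreeAlgebra.ι ℂ (Sum.inr s) * FreeAlgebra.ι ℂ (Sum.inl a))
      (FreeAlgebra.ι ℂ (Sum.inl a) * FreeAlgebra.ι ℂ (Sum.inr s) +
        FreeAlgebra.ι ℂ (Sum.inl (ratDeriv s a)))

/-- The ring `K⟨∂_s | s ∈ σ⟩` of differential operators with rational function coefficients. -/
def DiffOp (σ : Type) : Type := RingQuot (DiffOpRel σ)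

instance (σ : Type) : Ring (DiffOp σ) := inferInstanceAs (Ring (RingQuot (DiffOpRel σ)))

instance (σ : Type) : Algebra ℂ (DiffOp σ) :=
  inferInstanceAs (Algebra ℂ (RingQuot (DiffOpRel σ)))

/-- The quotient map from the free algebra to `K⟨∂_s | s ∈ σ⟩`. -/
def DiffOp.mk (σ : Type) : FreeAlgebra ℂ (RatFun σ ⊕ σ) →ₐ[ℂ] DiffOp σ :=
  RingQuot.mkAlgHom ℂ (DiffOpRel σ)

theorem DiffOp.mk_rel {σ : Type} {P Q : FreeAlgebra ℂ (RatFun σ ⊕ σ)} (h : DiffOpRel σ P Q) :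
    DiffOp.mk σ P = DiffOp.mk σ Q :=
  RingQuot.mkAlgHom_rel ℂ h

/-- The derivation `∂_s` as a differential operator. -/
def DiffOp.d {σ : Type} (s : σ) : DiffOp σ :=
  DiffOp.mk σ (FreeAlgebra.ι ℂ (Sum.inr s))

/-- A rational function as a differential operator of order zero. -/
def DiffOp.coeff (σ : Type) : RatFun σ →ₐ[ℂ] DiffOp σ :=
  AlgHom.mk
    { toFun := fun a => DiffOp.mk σ (FreeAlgebra.ι ℂ (Sum.inl a))
      map_one' := by
        have h := DiffOp.mk_rel (DiffOpRel.scalar (σ := σ) 1)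
        simpa using h
      map_zero' := by
        have h := DiffOp.mk_rel (DiffOpRel.scalar (σ := σ) 0)
        simpa using h
      map_mul' := fun a b => by
        have h := DiffOp.mk_rel (DiffOpRel.mul a b)
        simpa using h
      map_add' := fun a b => by
        have h := DiffOp.mk_rel (DiffOpRel.add a b)
        simpa using h }
    (fun c => by
      have h := DiffOp.mk_rel (DiffOpRel.scalar (σ := σ) c)
      rw [AlgHom.commutes] at h
      exact h)

theorem DiffOp.d_comm {σ : Type} (s t : σ) :
    DiffOp.d s * DiffOp.d t = DiffOp.d t * DiffOp.d s := by
  have h := DiffOp.mk_rel (DiffOpRel.d_comm s t)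
  simp only [map_mul] at h
  exact h

theorem DiffOp.d_mul_coeff {σ : Type} (s : σ) (a : RatFun σ) :
    DiffOp.d s * DiffOp.coeff σ a =
      DiffOp.coeff σ a * DiffOp.d s + DiffOp.coeff σ (ratDeriv s a) := by
  have h := DiffOp.mk_rel (DiffOpRel.leibniz s a)
  simp only [map_mul, map_add] at h
  exact h

/-- `K⟨∂⟩` is a vector space over `K` by multiplication on the left. -/
instance (σ : Type) : Module (RatFun σ) (DiffOp σ) :=
  Module.compHom (DiffOp σ) (DiffOp.coeff σ).toRingHom

instance (σ : Type) : IsScalarTower (RatFun σ) (DiffOp σ) (DiffOp σ) where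
  smul_assoc a P Q := mul_assoc (DiffOp.coeff σ a) P Q

/-- The natural homomorphism `D → K⟨∂⟩`, with `x_s ↦ x_s` and `∂_s ↦ ∂_s`. -/
def weylToDiffOp (σ : Type) : Weyl σ →ₐ[ℂ] DiffOp σ :=
  RingQuot.liftAlgHom ℂ (s := WeylRel σ)
    ⟨FreeAlgebra.lift ℂ (Sum.elim
        (fun s => DiffOp.coeff σ (algebraMap (MvPolynomial σ ℂ) (RatFun σ) (MvPolynomial.X s)))
        (fun s => DiffOp.d s)), by
      intro P Q h
      cases h with
      | x_comm s t =>
        simp only [map_mul, FreeAlgebra.lift_ι_apply, Sum.elim_inl]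
        rw [← map_mul (DiffOp.coeff σ), mul_comm, map_mul]
      | d_comm s t => simpa using DiffOp.d_comm s t
      | d_x_self s => simp [DiffOp.d_mul_coeff, ratDeriv_algebraMap]
      | d_x_of_ne s t h =>
        simp [DiffOp.d_mul_coeff, ratDeriv_algebraMap, MvPolynomial.pderiv_X_of_ne h.symm]⟩

/-- The left ideal `K⟨∂⟩ J` generated by a left ideal `J` of `D`. (`Ideal` means left ideal.) -/
def extendIdeal {σ : Type} (J : Ideal (Weyl σ)) : Ideal (DiffOp σ) :=
  Ideal.span (weylToDiffOp σ '' (J : Set (Weyl σ)))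

/-- The holonomic rank of a left ideal `J` of `D`: the dimension of the `K`-vector space
`K⟨∂⟩ / K⟨∂⟩ J`. -/
def holonomicRank {σ : Type} (J : Ideal (Weyl σ)) : Cardinal :=
  Module.rank (RatFun σ) (DiffOp σ ⧸ extendIdeal J)

/-! ## The diagonal Fisher–Bingham system -/

/-- The variables `x_ij` (`i ≤ j`), `y_k` and `r`. The indices `1, …, n + 1` are represented by
the elements `0, …, n` of `Fin (n + 1)`. -/
inductive Var (n : ℕ) : Type
  | x (i j : Fin (n + 1)) (h : i ≤ j) : Var n
  | y (k : Fin (n + 1)) : Var n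
  | r : Var n

section Generators

variable (n : ℕ)

/-- The variable `x_ii`. -/
def xx (i : Fin (n + 1)) : Weyl (Var n) := Weyl.x (Var.x i i le_rfl)

/-- The variable `y_i`. -/
def yy (i : Fin (n + 1)) : Weyl (Var n) := Weyl.x (Var.y i)

/-- The variable `r`. -/
def rr : Weyl (Var n) := Weyl.x Var.r

/-- The derivation `∂_ij = ∂/∂x_ij`, `i ≤ j`. -/
def dxx (i j : Fin (n + 1)) (h : i ≤ j) : Weyl (Var n) := Weyl.d (Var.x i j h)

/-- The derivation `∂_i = ∂/∂y_i`. -/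
def dy (i : Fin (n + 1)) : Weyl (Var n) := Weyl.d (Var.y i)

/-- The derivation `∂_r = ∂/∂r`. -/
def dr : Weyl (Var n) := Weyl.d Var.r

/-- `A_i = ∂_ii - ∂_i²`. -/
def opA (i : Fin (n + 1)) : Weyl (Var n) := dxx n i i le_rfl - dy n i ^ 2

/-- `B = ∑ ∂_i² - r²`. -/
def opB : Weyl (Var n) := ∑ i, dy n i ^ 2 - rr n ^ 2

/-- `C_ij = 2 (x_ii - x_jj) ∂_i ∂_j + y_i ∂_j - y_j ∂_i`. -/
def opC (i j : Fin (n + 1)) : Weyl (Var n) :=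
  2 * (xx n i - xx n j) * dy n i * dy n j + yy n i * dy n j - yy n j * dy n i

/-- `E = r ∂_r - 2 ∑ x_ii ∂_i² - ∑ y_i ∂_i - n`. -/
def opE : Weyl (Var n) :=
  rr n * dr n - 2 * ∑ i, xx n i * dy n i ^ 2 - ∑ i, yy n i * dy n i - (n : Weyl (Var n))

/-- The diagonal Fisher–Bingham system: the left ideal of `D` generated by the `A_i`, by `B`, by
the `C_ij` with `i < j`, by `E`, and by the `∂_ij` with `i < j`. -/
def diagonalSystem : Ideal (Weyl (Var n)) :=
  Ideal.span (Set.range (opA n) ∪ {opB n} ∪ {P | ∃ i j, i < j ∧ P = opC n i j} ∪ {opE n} ∪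
    {P | ∃ (i j : Fin (n + 1)) (h : i < j), P = dxx n i j h.le})

/-- The monomials `1`, `∂_k` for all `k`, and `∂_k²` for all `k` except the first index, as
elements of `K⟨∂⟩`. -/
def stdMonomial : Unit ⊕ Fin (n + 1) ⊕ Fin n → DiffOp (Var n)
  | Sum.inl _ => 1
  | Sum.inr (Sum.inl k) => DiffOp.d (Var.y k)
  | Sum.inr (Sum.inr k) => DiffOp.d (Var.y k.succ) ^ 2

end Generators

end

end FisherBingham

/-!
The rank is bounded below by a model of `K⟨∂⟩ / K⟨∂⟩ I` as a one-dimensional twisted cohomology.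
By a Laplace transform in `r²`, the Fisher–Bingham integral over the sphere of radius `r` becomes a
contour integral `∮ Φ ds` with
`Φ = r ∏ (s - x_ii)^(-1/2) exp (s r² + ∑ y_i² / (4 (s - x_ii)))`.
This suggests that `K⟨∂⟩` should act on the field `K(s)` by the twisted derivatives
`f ↦ Φ⁻¹ ∂(Φ f)`, which involve `Φ` only through its logarithmic derivatives, elements of `K(s)`
(`logDer`, `twisted`, `action`). They commute with each other and with the twisted `d/ds`, because
the derivations they come from commute (`twisted_comm`). So `K⟨∂⟩` acts on the cokernel of the
twisted `d/ds`, and the annihilator of the class of `1` there is a left ideal. It contains the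
Fisher–Bingham system (`extendIdeal_diagonalSystem_le`): `A_i`, `C_ij` and `∂_ij` kill `1` itself,
and `B` and `E` send `1` to the images of `-1` and of `2 s`.

The standard monomials send `1` to combinations of `1`, of `1 / (s - x_ii)` for all `i`, and of
`1 / (s - x_ii)²` for all `i` but the first. A combination of these functions that is the image of
some `h` under the twisted `d/ds` is zero (`eq_zero_of_twisted_eq_parFrac`): a pole of `h` would
give a pole of higher order in the image, so `h` is a polynomial, the growth at infinity makes `h`
constant, and the missing pole coefficient makes it zero. Hence the standard monomials are linearly
independent modulo the ideal.

The standard monomials span because their span in the quotient is stable under all derivations. For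
`∂_i = ∂/∂y_i` this follows from `C_ij` and `B`. The other derivations commute with the `∂_i`, so it
is enough that `∂_ii`, `∂_ij` and `r ∂_r` send the class of `1` into the span, which is what `A_i`,
`∂_ij` and `E` say.
-/

namespace FisherBingham

noncomputable section

/-! ### Derivations of rational functions in one variable -/

section Lift

theorem deriv_eq_of_algebraMap {R A L : Type*} [CommRing R] [CommRing A] [Field L] [Algebra R L]
    [Algebra A L] [IsFractionRing A L] {D₁ D₂ : Derivation R L L}
    (h : ∀ a : A, D₁ (algebraMap A L a) = D₂ (algebraMap A L a)) : D₁ = D₂ := by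
  ext f
  obtain ⟨a, b, hb, rfl⟩ := IsFractionRing.div_surjective (A := A) f
  rw [Derivation.leibniz_div, Derivation.leibniz_div, h, h]

variable {R A L : Type*} [CommRing R] [CommRing A] [Field L] [Algebra R A] [Algebra R L]
  [Algebra A L]

/-- The ring homomorphism `a ↦ a + D(a) ε` to the dual numbers. -/
def toDual (D : Derivation R A L) : A →+* TrivSqZeroExt L L where
  toFun a := TrivSqZeroExt.inl (algebraMap A L a) + TrivSqZeroExt.inr (D a)
  map_one' := by ext <;> simp
  map_zero' := by ext <;> simp
  map_add' p q := by ext <;> simp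
  map_mul' p q := by
    ext
    · simp
    · simp only [Derivation.leibniz, TrivSqZeroExt.snd_add, TrivSqZeroExt.snd_inl,
        TrivSqZeroExt.snd_inr, TrivSqZeroExt.snd_mul, TrivSqZeroExt.fst_add,
        TrivSqZeroExt.fst_inl, TrivSqZeroExt.fst_inr, map_mul, smul_eq_mul,
        MulOpposite.smul_eq_mul_unop, MulOpposite.unop_op, Algebra.smul_def]
      ring

theorem fst_toDual (D : Derivation R A L) (a : A) : (toDual D a).fst = algebraMap A L a := by
  simp [toDual]

theorem snd_toDual (D : Derivation R A L) (a : A) : (toDual D a).snd = D a := by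
  simp [toDual]

variable [IsFractionRing A L]

theorem isUnit_toDual (D : Derivation R A L) (a : nonZeroDivisors A) :
    IsUnit (toDual D a) := by
  rw [TrivSqZeroExt.isUnit_iff_isUnit_fst, fst_toDual]
  exact IsLocalization.map_units L a

/-- The extension of `toDual` to the field of fractions. -/
def fracToDual (D : Derivation R A L) : L →+* TrivSqZeroExt L L :=
  IsLocalization.lift (isUnit_toDual D)

theorem fracToDual_algebraMap (D : Derivation R A L) (a : A) :
    fracToDual D (algebraMap A L a) = toDual D a :=
  IsLocalization.lift_eq _ _

theorem fst_fracToDual (D : Derivation R A L) (f : L) : (fracToDual D f).fst = f := by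
  have h : (TrivSqZeroExt.fstHom ℤ L L).toRingHom.comp (fracToDual D) = RingHom.id L := by
    apply IsLocalization.ringHom_ext (nonZeroDivisors A)
    apply RingHom.ext
    intro p
    simp [fracToDual_algebraMap, fst_toDual]
  exact congrArg (fun g : L →+* L => g f) h

variable [IsScalarTower R A L]

/-- The extension of a derivation to the field of fractions. -/
def fracDeriv (D : Derivation R A L) : Derivation R L L :=
  Derivation.mk'
    { toFun := fun f => (fracToDual D f).snd
      map_add' := fun f g => by simp
      map_smul' := fun c f => by
        have h : fracToDual D (algebraMap R L c) = TrivSqZeroExt.inl (algebraMap R L c) := by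
          rw [IsScalarTower.algebraMap_apply R A L, fracToDual_algebraMap]
          ext
          · simp [fst_toDual]
          · simp [snd_toDual]
        simp [Algebra.smul_def, h] }
    (fun f g => by simp [fst_fracToDual, mul_comm])

theorem fracDeriv_algebraMap (D : Derivation R A L) (a : A) :
    fracDeriv D (algebraMap A L a) = D a := by
  change (fracToDual D (algebraMap A L a)).snd = _
  rw [fracToDual_algebraMap, snd_toDual]

end Lift

section OneVariable

open Polynomial

variable {K : Type*} [Field K] [Algebra ℂ K]

/-- The derivation `d/ds` of `K(s)`. -/
def sDeriv (K : Type*) [Field K] [Algebra ℂ K] : Derivation ℂ (RatFunc K) (RatFunc K) :=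
  fracDeriv (A := K[X]) ((Algebra.linearMap K[X] (RatFunc K)).compDer
    ((Polynomial.derivative' (R := K)).restrictScalars ℂ))

/-- The extension of a derivation of `K` to `K(s)` that is zero on `s`. -/
def coeffDeriv (δ : Derivation ℂ K K) : Derivation ℂ (RatFunc K) (RatFunc K) :=
  fracDeriv (A := K[X]) ((Algebra.linearMap K[X] (RatFunc K)).compDer
    ((PolynomialModule.equivPolynomialSelf (R := K)).toLinearMap.compDer δ.mapCoeffs))

theorem sDeriv_algebraMap (p : K[X]) :
    sDeriv K (algebraMap K[X] (RatFunc K) p) = algebraMap K[X] (RatFunc K) (derivative p) := by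
  rw [sDeriv, fracDeriv_algebraMap]
  rfl

theorem sDeriv_C (a : K) : sDeriv K (RatFunc.C a) = 0 := by
  rw [← RatFunc.algebraMap_C, sDeriv_algebraMap, derivative_C, map_zero]

theorem sDeriv_X : sDeriv K RatFunc.X = 1 := by
  rw [← RatFunc.algebraMap_X, sDeriv_algebraMap, derivative_X, map_one]

theorem coeffDeriv_C (δ : Derivation ℂ K K) (a : K) :
    coeffDeriv δ (RatFunc.C a) = RatFunc.C (δ a) := by
  rw [← RatFunc.algebraMap_C, coeffDeriv, fracDeriv_algebraMap, ← RatFunc.algebraMap_C]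
  change algebraMap K[X] (RatFunc K)
    (PolynomialModule.equivPolynomialSelf (δ.mapCoeffs (C a))) = _
  simp

theorem coeffDeriv_X (δ : Derivation ℂ K K) : coeffDeriv δ RatFunc.X = 0 := by
  rw [← RatFunc.algebraMap_X, coeffDeriv, fracDeriv_algebraMap]
  change algebraMap K[X] (RatFunc K)
    (PolynomialModule.equivPolynomialSelf (δ.mapCoeffs X)) = _
  simp

/-- A derivation of `K(s)` is determined by its values on `K` and on `s`. -/
theorem deriv_eq_of_C_of_X {D₁ D₂ : Derivation ℂ (RatFunc K) (RatFunc K)}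
    (hC : ∀ a, D₁ (RatFunc.C a) = D₂ (RatFunc.C a)) (hX : D₁ RatFunc.X = D₂ RatFunc.X) :
    D₁ = D₂ := by
  refine deriv_eq_of_algebraMap (A := K[X]) fun p => ?_
  induction p using Polynomial.induction_on' with
  | add p q hp hq => rw [map_add, map_add, map_add, hp, hq]
  | monomial k a =>
    rw [← C_mul_X_pow_eq_monomial, map_mul, map_pow, RatFunc.algebraMap_C, RatFunc.algebraMap_X]
    simp [hC, hX]

/-- Commutation of two derivations can be tested on `K` and on `s`, because their commutator is a
derivation. -/
theorem deriv_comm {D₁ D₂ : Derivation ℂ (RatFunc K) (RatFunc K)}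
    (hC : ∀ a, D₁ (D₂ (RatFunc.C a)) = D₂ (D₁ (RatFunc.C a)))
    (hX : D₁ (D₂ RatFunc.X) = D₂ (D₁ RatFunc.X)) (f : RatFunc K) : D₁ (D₂ f) = D₂ (D₁ f) := by
  have h : ⁅D₁, D₂⁆ = 0 := by
    refine deriv_eq_of_C_of_X (fun a => ?_) ?_
    · rw [Derivation.commutator_apply, hC, sub_self, Derivation.zero_apply]
    · rw [Derivation.commutator_apply, hX, sub_self, Derivation.zero_apply]
  rw [← sub_eq_zero, ← Derivation.commutator_apply, h, Derivation.zero_apply]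

theorem coeffDeriv_comm {δ₁ δ₂ : Derivation ℂ K K} (h : ∀ a, δ₁ (δ₂ a) = δ₂ (δ₁ a))
    (f : RatFunc K) :
    coeffDeriv δ₁ (coeffDeriv δ₂ f) = coeffDeriv δ₂ (coeffDeriv δ₁ f) :=
  deriv_comm (fun a => by simp [coeffDeriv_C, h]) (by simp [coeffDeriv_X]) f

theorem coeffDeriv_sDeriv (δ : Derivation ℂ K K) (f : RatFunc K) :
    coeffDeriv δ (sDeriv K f) = sDeriv K (coeffDeriv δ f) :=
  deriv_comm (fun a => by simp [coeffDeriv_C, sDeriv_C]) (by simp [coeffDeriv_X, sDeriv_X]) f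

/-! ### Poles and twisted derivatives -/

/-- A solution `h` of `h' + (W / Q²) h = N / Q²` is a polynomial if `W` and `Q` are coprime: at a
pole of `h`, the derivative `h'` or, if the pole is a zero of `Q`, the term `(W / Q²) h` has a pole
of higher order than the other terms. -/
theorem exists_polynomial_of_twisted [CharZero K] {Q W N : K[X]}
    (hQ : Q ≠ 0) (hW : IsCoprime W Q) {h : RatFunc K}
    (hh : sDeriv K h * algebraMap K[X] (RatFunc K) Q ^ 2 + algebraMap K[X] (RatFunc K) W * h =
      algebraMap K[X] (RatFunc K) N) :
    ∃ p : K[X], h = algebraMap K[X] (RatFunc K) p := by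
  obtain ⟨p, q, hpq, hq0, rfl⟩ : ∃ p q : K[X], IsCoprime p q ∧ q ≠ 0 ∧
      h = algebraMap K[X] (RatFunc K) p / algebraMap K[X] (RatFunc K) q :=
    ⟨h.num, h.denom, h.isCoprime_num_denom, h.denom_ne_zero, (RatFunc.num_div_denom h).symm⟩
  have hq0' : algebraMap K[X] (RatFunc K) q ≠ 0 := RatFunc.algebraMap_ne_zero hq0
  -- the equation without denominators
  have key : p * derivative q * Q ^ 2 = q * (derivative p * Q ^ 2 + W * p - N * q) := by
    apply RatFunc.algebraMap_injective K
    rw [Derivation.leibniz_div, sDeriv_algebraMap, sDeriv_algebraMap] at hh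
    simp only [smul_eq_mul] at hh
    field_simp at hh
    simp only [map_mul, map_sub, map_add, map_pow]
    linear_combination -hh
  by_cases hu : IsUnit q
  · obtain ⟨c, -, rfl⟩ := Polynomial.isUnit_iff.mp hu
    refine ⟨p * C c⁻¹, ?_⟩
    rw [map_mul, RatFunc.algebraMap_C, RatFunc.algebraMap_C, map_inv₀, div_eq_mul_inv]
  · exfalso
    obtain ⟨π, hπ, hπq⟩ := WfDvdMonoid.exists_irreducible_factor hu hq0
    obtain ⟨m, u, hπu, hqu⟩ := WfDvdMonoid.max_power_factor hq0 hπ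
    have hprime : Prime π := hπ.prime
    obtain ⟨m, rfl⟩ : ∃ k, m = k + 1 := by
      rcases m with _ | k
      · rw [pow_zero, one_mul] at hqu
        exact absurd (hqu ▸ hπq) hπu
      · exact ⟨k, rfl⟩
    have hπp : ¬ π ∣ p := fun hd => hπ.not_isUnit (hpq.isUnit_of_dvd' hd hπq)
    have hπ' : ¬ π ∣ derivative π := fun hd =>
      hπ.not_isUnit (hπ.separable.isUnit_of_dvd' dvd_rfl hd)
    have hmu : ¬ π ∣ C ((m + 1 : ℕ) : K) := fun hd =>
      hπ.not_isUnit (isUnit_of_dvd_unit hd (isUnit_C.mpr (by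
        rw [isUnit_iff_ne_zero]; exact_mod_cast Nat.succ_ne_zero m)))
    -- cancel `π ^ m`, which divides both sides
    have hd : derivative q =
        π ^ m * (C ((m + 1 : ℕ) : K) * derivative π * u + π * derivative u) := by
      rw [hqu, derivative_mul, derivative_pow, Nat.add_sub_cancel]
      ring
    have key2 : p * (C ((m + 1 : ℕ) : K) * derivative π * u + π * derivative u) * Q ^ 2 =
        π * u * (derivative p * Q ^ 2 + W * p - N * q) := by
      apply mul_left_cancel₀ (pow_ne_zero m hπ.ne_zero)
      rw [hd] at key
      linear_combination key + (derivative p * Q ^ 2 + W * p - N * q) * hqu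
    by_cases hπQ : π ∣ Q
    · -- at a zero of `Q` the term `W h` has a higher pole than the other two
      obtain ⟨Q', rfl⟩ := hπQ
      have h3 : π ∣ u * (W * p) := by
        obtain ⟨q', rfl⟩ := hπq
        refine ⟨p * (C ((m + 1 : ℕ) : K) * derivative π * u + π * derivative u) * Q' ^ 2
          - u * (derivative p * π * Q' ^ 2) + u * N * q', ?_⟩
        apply mul_left_cancel₀ hπ.ne_zero
        linear_combination -key2
      have h4 : π ∣ W := by
        rcases hprime.dvd_or_dvd h3 with h | h
        · exact absurd h hπu
        · exact (hprime.dvd_or_dvd h).resolve_right hπp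
      exact hπ.not_isUnit (hW.isUnit_of_dvd' h4 (dvd_mul_right _ _))
    · -- elsewhere the derivative has a higher pole
      have h3 : π ∣ p * (C ((m + 1 : ℕ) : K) * derivative π * u) * Q ^ 2 := by
        refine ⟨u * (derivative p * Q ^ 2 + W * p - N * q) - p * derivative u * Q ^ 2, ?_⟩
        linear_combination key2
      rcases hprime.dvd_or_dvd h3 with h | h
      · rcases hprime.dvd_or_dvd h with h | h
        · exact hπp h
        · rcases hprime.dvd_or_dvd h with h | h
          · rcases hprime.dvd_or_dvd h with h | h
            · exact hmu h
            · exact hπ' h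
          · exact hπu h
      · exact hπQ (hprime.dvd_of_dvd_pow h)

end OneVariable

/-! ### Partial fractions with double poles -/

section PartialFractions

open Polynomial

variable {K : Type*} [Field K] {ι : Type*} [Fintype ι] [DecidableEq ι]

/-- The function `s - x_i` in `K(s)`. -/
def ell (x : ι → K) (i : ι) : RatFunc K := RatFunc.X - RatFunc.C (x i)

omit [Fintype ι] [DecidableEq ι] in
theorem ell_eq (x : ι → K) (i : ι) : ell x i = algebraMap K[X] (RatFunc K) (X - C (x i)) := by
  rw [ell, map_sub, RatFunc.algebraMap_X, RatFunc.algebraMap_C]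

omit [Fintype ι] [DecidableEq ι] in
theorem ell_ne_zero (x : ι → K) (i : ι) : ell x i ≠ 0 := by
  rw [ell_eq]
  exact RatFunc.algebraMap_ne_zero (X_sub_C_ne_zero _)

/-- The rational function `a + ∑ b_i / (s - x_i) + ∑ c_i / (s - x_i)²`. -/
def parFrac (x : ι → K) (a : K) (b c : ι → K) : RatFunc K :=
  RatFunc.C a + ∑ i, RatFunc.C (b i) / ell x i + ∑ i, RatFunc.C (c i) / ell x i ^ 2

/-- The product of all `s - x_j`. -/
def nodal (x : ι → K) : K[X] := ∏ j, (X - C (x j))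

/-- The product of all `s - x_j` with `j ≠ i`. -/
def nodalErase (x : ι → K) (i : ι) : K[X] := ∏ j ∈ Finset.univ.erase i, (X - C (x j))

/-- The numerator of `parFrac x a b c` over the denominator `∏ (s - x_j)²`. -/
def parNum (x : ι → K) (a : K) (b c : ι → K) : K[X] :=
  C a * nodal x ^ 2 + ∑ i, C (b i) * (nodal x * nodalErase x i) + ∑ i, C (c i) * nodalErase x i ^ 2

theorem nodal_eq (x : ι → K) (i : ι) : nodal x = (X - C (x i)) * nodalErase x i :=
  (Finset.mul_prod_erase _ _ (Finset.mem_univ i)).symm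

omit [DecidableEq ι] in
theorem nodal_ne_zero (x : ι → K) : nodal x ≠ 0 :=
  Finset.prod_ne_zero_iff.mpr fun _ _ => X_sub_C_ne_zero _

omit [DecidableEq ι] in
theorem natDegree_nodal (x : ι → K) : (nodal x).natDegree = Fintype.card ι := by
  rw [nodal, natDegree_finsetProd_X_sub_C_eq_card, Finset.card_univ]

omit [DecidableEq ι] in
theorem monic_nodal (x : ι → K) : (nodal x).Monic := monic_prod_X_sub_C _ _

theorem natDegree_nodalErase (x : ι → K) (i : ι) :
    (nodalErase x i).natDegree + 1 = Fintype.card ι := by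
  rw [nodalErase, natDegree_finsetProd_X_sub_C_eq_card,
    Finset.card_erase_add_one (Finset.mem_univ i), Finset.card_univ]

theorem algebraMap_parNum (x : ι → K) (a : K) (b c : ι → K) :
    algebraMap K[X] (RatFunc K) (parNum x a b c) =
      parFrac x a b c * algebraMap K[X] (RatFunc K) (nodal x) ^ 2 := by
  have h (i : ι) : algebraMap K[X] (RatFunc K) (nodal x) =
      ell x i * algebraMap K[X] (RatFunc K) (nodalErase x i) := by
    rw [nodal_eq x i, map_mul, ell_eq]
  simp only [parNum, parFrac, map_add, map_mul, map_pow, map_sum, RatFunc.algebraMap_C, add_mul,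
    Finset.sum_mul]
  congr 1
  · congr 1
    refine Finset.sum_congr rfl fun i _ => ?_
    rw [h i]
    field_simp [ell_ne_zero x i]
  · refine Finset.sum_congr rfl fun i _ => ?_
    rw [h i]
    field_simp [ell_ne_zero x i]

theorem natDegree_nodal_mul_nodalErase_lt (x : ι → K) (i : ι) :
    (nodal x * nodalErase x i).natDegree < 2 * Fintype.card ι := by
  have h1 := natDegree_nodalErase x i
  have h2 := natDegree_nodal x
  have h3 := natDegree_mul_le (p := nodal x) (q := nodalErase x i)
  omega

theorem natDegree_nodalErase_sq_lt (x : ι → K) (i : ι) :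
    (nodalErase x i ^ 2).natDegree < 2 * Fintype.card ι := by
  have h1 := natDegree_nodalErase x i
  have h3 := natDegree_pow_le (p := nodalErase x i) (n := 2)
  omega

theorem natDegree_parNum_le (x : ι → K) (a : K) (b c : ι → K) :
    (parNum x a b c).natDegree ≤ 2 * Fintype.card ι := by
  refine natDegree_add_le_of_degree_le (natDegree_add_le_of_degree_le ?_ ?_) ?_
  · refine (natDegree_C_mul_le _ _).trans ?_
    rw [(monic_nodal x).natDegree_pow, natDegree_nodal]
  · exact natDegree_sum_le_of_forall_le _ _ fun i _ =>
      (natDegree_C_mul_le _ _).trans (natDegree_nodal_mul_nodalErase_lt x i).le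
  · exact natDegree_sum_le_of_forall_le _ _ fun i _ =>
      (natDegree_C_mul_le _ _).trans (natDegree_nodalErase_sq_lt x i).le

theorem coeff_parNum (x : ι → K) (a : K) (b c : ι → K) :
    (parNum x a b c).coeff (2 * Fintype.card ι) = a := by
  have h1 : (nodal x ^ 2).coeff (2 * Fintype.card ι) = 1 := by
    have h := ((monic_nodal x).pow 2).coeff_natDegree
    rwa [(monic_nodal x).natDegree_pow, natDegree_nodal] at h
  simp only [parNum, coeff_add, finsetSum_coeff, coeff_C_mul, h1,
    coeff_eq_zero_of_natDegree_lt (natDegree_nodal_mul_nodalErase_lt x _),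
    coeff_eq_zero_of_natDegree_lt (natDegree_nodalErase_sq_lt x _)]
  simp

theorem eval_nodal (x : ι → K) (i : ι) : (nodal x).eval (x i) = 0 := by
  rw [nodal_eq x i]
  simp

theorem eval_nodalErase_of_ne (x : ι → K) {i j : ι} (h : j ≠ i) :
    (nodalErase x i).eval (x j) = 0 := by
  rw [nodalErase, eval_prod]
  exact Finset.prod_eq_zero (Finset.mem_erase.mpr ⟨h, Finset.mem_univ j⟩) (by simp)

theorem eval_nodalErase_ne_zero {x : ι → K} (hx : Function.Injective x) (i : ι) :
    (nodalErase x i).eval (x i) ≠ 0 := by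
  rw [nodalErase, eval_prod, Finset.prod_ne_zero_iff]
  intro j hj
  rw [eval_sub, eval_X, eval_C, sub_ne_zero]
  exact fun h => (Finset.mem_erase.mp hj).1 (hx h).symm

theorem eval_parNum (x : ι → K) (a : K) (b c : ι → K) (i : ι) :
    (parNum x a b c).eval (x i) = c i * (nodalErase x i).eval (x i) ^ 2 := by
  simp only [parNum, eval_add, eval_finsetSum, eval_mul, eval_pow, eval_C, eval_nodal,
    zero_mul, mul_zero, ne_eq, OfNat.ofNat_ne_zero, not_false_eq_true, zero_pow,
    Finset.sum_const_zero, zero_add]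
  refine Finset.sum_eq_single_of_mem i (Finset.mem_univ i) fun j _ hj => ?_
  rw [eval_nodalErase_of_ne x hj.symm]
  simp

theorem eq_zero_of_parNum_eq_zero {x : ι → K} (hx : Function.Injective x) {a : K} {b c : ι → K}
    (h : parNum x a b c = 0) : a = 0 ∧ b = 0 ∧ c = 0 := by
  have ha : a = 0 := by rw [← coeff_parNum x a b c, h, coeff_zero]
  have hc : c = 0 := by
    funext i
    have hi := eval_parNum x a b c i
    rw [h, eval_zero, eq_comm, mul_eq_zero] at hi
    exact hi.resolve_right (pow_ne_zero 2 (eval_nodalErase_ne_zero hx i))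
  refine ⟨ha, ?_, hc⟩
  subst ha hc
  have h2 : nodal x * ∑ j, C (b j) * nodalErase x j = 0 := by
    rw [← h, parNum, Finset.mul_sum]
    simp only [map_zero, zero_mul, zero_add, Pi.zero_apply, Finset.sum_const_zero, add_zero]
    exact Finset.sum_congr rfl fun j _ => by ring
  have h3 := (mul_eq_zero.mp h2).resolve_left (nodal_ne_zero x)
  funext i
  have hi := congrArg (eval (x i)) h3
  rw [eval_finsetSum, Finset.sum_eq_single_of_mem i (Finset.mem_univ i), eval_zero, eval_mul,
    eval_C, mul_eq_zero] at hi
  · exact hi.resolve_right (eval_nodalErase_ne_zero hx i)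
  · intro j _ hj
    rw [eval_mul, eval_nodalErase_of_ne x hj.symm, mul_zero]

/-- The functions `1`, `1 / (s - x_i)` for all `i` and `1 / (s - x_i)²` for all `i ≠ i₀` are linearly
independent modulo the image of the twisted derivative `h ↦ h' + w h`. -/
theorem eq_zero_of_twisted_eq_parFrac [CharZero K] [Algebra ℂ K] {x : ι → K}
    (hx : Function.Injective x) {ρ : K} {β γ : ι → K} (hρ : ρ ≠ 0) (hγ : ∀ i, γ i ≠ 0)
    {a : K} {b c : ι → K} {i₀ : ι} (hc : c i₀ = 0) {h : RatFunc K}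
    (hh : sDeriv K h + parFrac x ρ β γ * h = parFrac x a b c) :
    a = 0 ∧ b = 0 ∧ c = 0 := by
  have hcop : IsCoprime (parNum x ρ β γ) (nodal x) := by
    refine IsCoprime.prod_right fun i _ => IsCoprime.symm ?_
    rw [(irreducible_X_sub_C (x i)).coprime_iff_not_dvd, dvd_iff_isRoot, IsRoot, eval_parNum]
    exact mul_ne_zero (hγ i) (pow_ne_zero 2 (eval_nodalErase_ne_zero hx i))
  obtain ⟨p, rfl⟩ := exists_polynomial_of_twisted (nodal_ne_zero x) hcop
    (N := parNum x a b c) (h := h) (by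
      rw [algebraMap_parNum, algebraMap_parNum, ← hh]
      ring)
  have hp : derivative p * nodal x ^ 2 + parNum x ρ β γ * p = parNum x a b c := by
    apply RatFunc.algebraMap_injective K
    rw [map_add, map_mul, map_mul, map_pow, algebraMap_parNum, algebraMap_parNum, ← hh,
      sDeriv_algebraMap]
    ring
  -- compare the coefficients of highest degree: `p` is constant
  have hdeg : p.natDegree = 0 := by
    by_contra hd
    have h1 : (derivative p * nodal x ^ 2).coeff (2 * Fintype.card ι + p.natDegree) = 0 := by
      apply coeff_eq_zero_of_natDegree_lt
      have e1 := natDegree_mul_le (p := derivative p) (q := nodal x ^ 2)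
      have e2 := natDegree_derivative_lt hd
      rw [(monic_nodal x).natDegree_pow, natDegree_nodal] at e1
      omega
    have h2 : (parNum x a b c).coeff (2 * Fintype.card ι + p.natDegree) = 0 := by
      apply coeff_eq_zero_of_natDegree_lt
      have e1 := natDegree_parNum_le x a b c
      omega
    rw [← hp, coeff_add, h1, zero_add,
      coeff_mul_add_eq_of_natDegree_le (natDegree_parNum_le x ρ β γ) le_rfl, coeff_parNum,
      coeff_natDegree, mul_eq_zero] at h2
    rcases h2 with h2 | h2
    · exact hρ h2
    · exact hd (by rw [leadingCoeff_eq_zero.mp h2, natDegree_zero])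
  obtain ⟨k, rfl⟩ := natDegree_eq_zero.mp hdeg
  -- compare the values at `x i₀`: the constant is zero
  have hk : k = 0 := by
    have h1 := congrArg (eval (x i₀)) hp
    rw [eval_add, derivative_C, zero_mul, eval_zero, zero_add, eval_mul, eval_C, eval_parNum,
      eval_parNum, hc, zero_mul, mul_eq_zero, mul_eq_zero] at h1
    exact h1.resolve_left fun h2 => h2.elim (hγ i₀)
      (pow_ne_zero 2 (eval_nodalErase_ne_zero hx i₀))
  refine eq_zero_of_parNum_eq_zero hx ?_
  rw [← hp, hk]
  simp

end PartialFractions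

/-! ### Logarithmic derivatives and twisted derivatives -/

section Twist

variable {K : Type*} [Field K] [Algebra ℂ K] {ι : Type*} [Fintype ι]

/-- The exponent `s r² + ∑ y_i² / (4 (s - x_i))` of the twisting function, in `K(s)`. -/
def expPart (x y : ι → K) (r : K) : RatFunc K :=
  RatFunc.X * RatFunc.C r ^ 2 + ∑ i, RatFunc.C (y i) ^ 2 / (4 * ell x i)

/-- The logarithmic derivative `D(Φ) / Φ` of the multivalued function
`Φ = r ∏ (s - x_i)^(-1/2) exp (s r² + ∑ y_i² / (4 (s - x_i)))`. -/
def logDer (x y : ι → K) (r : K) (D : Derivation ℂ (RatFunc K) (RatFunc K)) : RatFunc K :=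
  D (expPart x y r) + D (RatFunc.C r) / RatFunc.C r - ∑ i, D (ell x i) / (2 * ell x i)

/-- The twisted derivative `f ↦ Φ⁻¹ D(Φ f) = D(f) + (D(Φ) / Φ) f`. -/
def twisted (x y : ι → K) (r : K) (D : Derivation ℂ (RatFunc K) (RatFunc K)) :
    RatFunc K →ₗ[ℂ] RatFunc K :=
  D.toLinearMap + LinearMap.mulLeft ℂ (logDer x y r D)

theorem twisted_apply (x y : ι → K) (r : K) (D : Derivation ℂ (RatFunc K) (RatFunc K))
    (f : RatFunc K) : twisted x y r D f = D f + logDer x y r D * f := rfl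

theorem deriv_two {L : Type*} [Field L] [Algebra ℂ L] (D : Derivation ℂ L L) : D 2 = 0 := by
  simpa using D.map_natCast 2

theorem deriv_four {L : Type*} [Field L] [Algebra ℂ L] (D : Derivation ℂ L L) : D 4 = 0 := by
  simpa using D.map_natCast 4

theorem deriv_div_comm {L : Type*} [Field L] [Algebra ℂ L] {D₁ D₂ : Derivation ℂ L L}
    (h : ∀ f, D₁ (D₂ f) = D₂ (D₁ f)) (f : L) : D₁ (D₂ f / f) = D₂ (D₁ f / f) := by
  rw [Derivation.leibniz_div, Derivation.leibniz_div, h]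
  simp only [smul_eq_mul]
  ring

/-- The form `d log Φ` is closed. -/
theorem logDer_symm (x y : ι → K) (r : K) {D₁ D₂ : Derivation ℂ (RatFunc K) (RatFunc K)}
    (h : ∀ f, D₁ (D₂ f) = D₂ (D₁ f)) : D₁ (logDer x y r D₂) = D₂ (logDer x y r D₁) := by
  have h2 (D : Derivation ℂ (RatFunc K) (RatFunc K)) (f : RatFunc K) : D (2⁻¹ * f) = 2⁻¹ * D f := by
    rw [Derivation.leibniz, Derivation.leibniz_inv, deriv_two]
    simp
  have e (f g : RatFunc K) : f / (2 * g) = 2⁻¹ * (f / g) := by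
    rw [div_mul_eq_div_div_swap, div_eq_inv_mul]
  simp only [logDer, map_add, map_sub, map_sum, e, h2, h, deriv_div_comm h]

theorem twisted_comm (x y : ι → K) (r : K) {D₁ D₂ : Derivation ℂ (RatFunc K) (RatFunc K)}
    (h : ∀ f, D₁ (D₂ f) = D₂ (D₁ f)) (f : RatFunc K) :
    twisted x y r D₁ (twisted x y r D₂ f) = twisted x y r D₂ (twisted x y r D₁ f) := by
  simp only [twisted_apply, map_add, Derivation.leibniz, smul_eq_mul, h, logDer_symm x y r h]
  ring

theorem twisted_mul (x y : ι → K) (r : K) (D : Derivation ℂ (RatFunc K) (RatFunc K))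
    (f g : RatFunc K) : twisted x y r D (f * g) = f * twisted x y r D g + D f * g := by
  simp only [twisted_apply, Derivation.leibniz, smul_eq_mul]
  ring

theorem logDer_eq (x y : ι → K) {r : K} (D : Derivation ℂ (RatFunc K) (RatFunc K)) :
    logDer x y r D = D RatFunc.X * RatFunc.C r ^ 2 +
      2 * RatFunc.X * RatFunc.C r * D (RatFunc.C r) + D (RatFunc.C r) / RatFunc.C r +
      ∑ i, (RatFunc.C (y i) * D (RatFunc.C (y i)) / (2 * ell x i) -
        RatFunc.C (y i) ^ 2 * D (ell x i) / (4 * ell x i ^ 2) - D (ell x i) / (2 * ell x i)) := by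
  have : CharZero K := charZero_of_injective_algebraMap (algebraMap ℂ K).injective
  have h4 : (4 : RatFunc K) ≠ 0 := by norm_num
  have h2 : (2 : RatFunc K) ≠ 0 := by norm_num
  simp only [logDer, expPart, map_add, map_sum]
  rw [Finset.sum_sub_distrib]
  have e (i : ι) : D (RatFunc.C (y i) ^ 2 / (4 * ell x i)) =
      RatFunc.C (y i) * D (RatFunc.C (y i)) / (2 * ell x i) -
        RatFunc.C (y i) ^ 2 * D (ell x i) / (4 * ell x i ^ 2) := by
    have h0 := ell_ne_zero x i
    rw [Derivation.leibniz_div, Derivation.leibniz, Derivation.leibniz_pow, deriv_four]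
    simp only [smul_eq_mul, nsmul_eq_mul]
    field_simp
    push_cast
    ring
  simp only [e, Derivation.leibniz, Derivation.leibniz_pow, smul_eq_mul, nsmul_eq_mul]
  push_cast
  ring

end Twist

section Formulas

variable {K : Type*} [Field K] [Algebra ℂ K] {ι : Type*} [Fintype ι] {x y : ι → K} {r : K}

omit [Fintype ι] in
theorem coeffDeriv_ell (δ : Derivation ℂ K K) (x : ι → K) (i : ι) :
    coeffDeriv δ (ell x i) = -RatFunc.C (δ (x i)) := by
  rw [ell, map_sub, coeffDeriv_X, coeffDeriv_C, zero_sub]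

theorem logDer_coeffDeriv (x y : ι → K) (r : K) (δ : Derivation ℂ K K) :
    logDer x y r (coeffDeriv δ) = 2 * RatFunc.X * RatFunc.C r * RatFunc.C (δ r) +
      RatFunc.C (δ r) / RatFunc.C r +
      ∑ i, (RatFunc.C (y i) * RatFunc.C (δ (y i)) / (2 * ell x i) +
        RatFunc.C (y i) ^ 2 * RatFunc.C (δ (x i)) / (4 * ell x i ^ 2) +
        RatFunc.C (δ (x i)) / (2 * ell x i)) := by
  rw [logDer_eq]
  simp only [coeffDeriv_X, coeffDeriv_C, coeffDeriv_ell, zero_mul, zero_add]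
  congr 1
  exact Finset.sum_congr rfl fun i _ => by ring

theorem logDer_eq_zero {δ : Derivation ℂ K K} (hx : ∀ i, δ (x i) = 0) (hy : ∀ i, δ (y i) = 0)
    (hr : δ r = 0) : logDer x y r (coeffDeriv δ) = 0 := by
  simp [logDer_coeffDeriv, hr, hx, hy]

theorem logDer_y {δ : Derivation ℂ K K} {k : ι} (hx : ∀ i, δ (x i) = 0) (hk : δ (y k) = 1)
    (hy : ∀ i, i ≠ k → δ (y i) = 0) (hr : δ r = 0) :
    logDer x y r (coeffDeriv δ) = RatFunc.C (y k) / (2 * ell x k) := by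
  rw [logDer_coeffDeriv, Finset.sum_eq_single_of_mem k (Finset.mem_univ k)]
  · simp [hr, hx, hk]
  · intro i _ hi
    simp [hx, hy i hi]

/-- The logarithmic derivative of the twisting function with respect to `x_k`. -/
def quadTerm (x y : ι → K) (k : ι) : RatFunc K :=
  RatFunc.C (y k) ^ 2 / (4 * ell x k ^ 2) + 1 / (2 * ell x k)

theorem logDer_x {δ : Derivation ℂ K K} {k : ι} (hk : δ (x k) = 1)
    (hx : ∀ i, i ≠ k → δ (x i) = 0) (hy : ∀ i, δ (y i) = 0) (hr : δ r = 0) :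
    logDer x y r (coeffDeriv δ) = quadTerm x y k := by
  rw [logDer_coeffDeriv, Finset.sum_eq_single_of_mem k (Finset.mem_univ k)]
  · simp [quadTerm, hr, hy, hk]
  · intro i _ hi
    simp [hy, hx i hi]

theorem logDer_r {δ : Derivation ℂ K K} (hx : ∀ i, δ (x i) = 0) (hy : ∀ i, δ (y i) = 0)
    (hr : δ r = 1) :
    logDer x y r (coeffDeriv δ) = 2 * RatFunc.X * RatFunc.C r + 1 / RatFunc.C r := by
  simp [logDer_coeffDeriv, hr, hx, hy]

omit [Fintype ι] in
theorem coeffDeriv_div_ell {δ : Derivation ℂ K K} {k : ι} (hx : δ (x k) = 0) :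
    coeffDeriv δ (RatFunc.C (y k) / (2 * ell x k)) = RatFunc.C (δ (y k)) / (2 * ell x k) := by
  have : CharZero K := charZero_of_injective_algebraMap (algebraMap ℂ K).injective
  have h0 := ell_ne_zero x k
  have h2 : (2 : RatFunc K) ≠ 0 := by norm_num
  rw [Derivation.leibniz_div, Derivation.leibniz, coeffDeriv_ell, coeffDeriv_C, hx, deriv_two]
  simp only [map_zero, neg_zero, smul_eq_mul]
  field_simp
  ring

omit [Algebra ℂ K] [Fintype ι] in
theorem one_div_add_mul_self (x y : ι → K) (k : ι) :
    RatFunc.C 1 / (2 * ell x k) +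
      RatFunc.C (y k) / (2 * ell x k) * (RatFunc.C (y k) / (2 * ell x k)) = quadTerm x y k := by
  rw [quadTerm, map_one, add_comm, div_mul_div_comm]
  congr 2 <;> ring

theorem twisted_sDeriv_apply (x y : ι → K) (r : K) (f : RatFunc K) :
    twisted x y r (sDeriv K) f = sDeriv K f + (RatFunc.C r ^ 2 - ∑ i, quadTerm x y i) * f := by
  have he (i) : sDeriv K (ell x i) = 1 := by
    rw [ell, map_sub, sDeriv_X, sDeriv_C, sub_zero]
  rw [twisted_apply, logDer_eq, sub_eq_add_neg _ (∑ i, _), ← Finset.sum_neg_distrib]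
  simp only [sDeriv_X, sDeriv_C, he, mul_zero, zero_div, add_zero, one_mul, mul_one]
  congr 3
  exact Finset.sum_congr rfl fun i _ => by rw [quadTerm]; ring

/-- The right-hand side is the image of `1` under `B`. -/
theorem twisted_sDeriv_neg_one (x y : ι → K) (r : K) :
    twisted x y r (sDeriv K) (-1) = ∑ i, quadTerm x y i - RatFunc.C r ^ 2 := by
  rw [twisted_sDeriv_apply, map_neg, Derivation.map_one_eq_zero]
  ring

omit [Fintype ι] in
/-- The operator `C_ij` annihilates `1`. -/
theorem mixed_relation (x y : ι → K) (i j : ι) :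
    2 * (RatFunc.C (x i) - RatFunc.C (x j)) *
          (RatFunc.C (y i) / (2 * ell x i) * (RatFunc.C (y j) / (2 * ell x j))) +
        RatFunc.C (y i) * (RatFunc.C (y j) / (2 * ell x j)) -
      RatFunc.C (y j) * (RatFunc.C (y i) / (2 * ell x i)) = 0 := by
  have : CharZero K := charZero_of_injective_algebraMap (algebraMap ℂ K).injective
  have h1 := ell_ne_zero x i
  have h2 := ell_ne_zero x j
  have h3 : RatFunc.C (x i) = RatFunc.X - ell x i := by simp [ell]
  have h4 : RatFunc.C (x j) = RatFunc.X - ell x j := by simp [ell]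
  have h5 : (2 : RatFunc K) ≠ 0 := by norm_num
  rw [h3, h4]
  field_simp
  ring

/-- The right-hand side is the image of `1` under `E`, where the number of the `x_i` is `n + 1`. -/
theorem twisted_sDeriv_two_mul_X (x y : ι → K) {r : K} (hr : r ≠ 0) :
    twisted x y r (sDeriv K) (2 * RatFunc.X) =
      RatFunc.C r * (2 * RatFunc.X * RatFunc.C r + 1 / RatFunc.C r) -
        2 * ∑ i, RatFunc.C (x i) * quadTerm x y i -
        ∑ i, RatFunc.C (y i) * (RatFunc.C (y i) / (2 * ell x i)) -
          ((Fintype.card ι : RatFunc K) - 1) := by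
  have : CharZero K := charZero_of_injective_algebraMap (algebraMap ℂ K).injective
  have hr' : RatFunc.C r ≠ 0 := (map_ne_zero RatFunc.C).mpr hr
  have h5 : (2 : RatFunc K) ≠ 0 := by norm_num
  have h6 : (4 : RatFunc K) ≠ 0 := by norm_num
  have e (i : ι) : quadTerm x y i * (2 * RatFunc.X) = 2 * (RatFunc.C (x i) * quadTerm x y i) +
      RatFunc.C (y i) * (RatFunc.C (y i) / (2 * ell x i)) + 1 := by
    have h1 := ell_ne_zero x i
    have h3 : RatFunc.C (x i) = RatFunc.X - ell x i := by simp [ell]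
    rw [h3, quadTerm]
    field_simp
    ring
  have hs : (∑ i, quadTerm x y i) * (2 * RatFunc.X) = 2 * ∑ i, RatFunc.C (x i) * quadTerm x y i +
      ∑ i, RatFunc.C (y i) * (RatFunc.C (y i) / (2 * ell x i)) + (Fintype.card ι : RatFunc K) := by
    rw [Finset.sum_mul, Finset.sum_congr rfl fun i _ => e i, Finset.sum_add_distrib,
      Finset.sum_add_distrib, Finset.mul_sum]
    simp
  rw [twisted_sDeriv_apply, Derivation.leibniz, sDeriv_X, deriv_two, sub_mul, hs]
  simp only [smul_eq_mul, mul_zero, add_zero, mul_one]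
  field_simp
  ring

omit [Algebra ℂ K] in
theorem sub_sum_quadTerm (x y : ι → K) (r : K) :
    RatFunc.C r ^ 2 - ∑ i, quadTerm x y i =
      parFrac x (r ^ 2) (fun _ => -(1 / 2)) (fun i => -(y i ^ 2 / 4)) := by
  rw [parFrac, add_assoc, ← Finset.sum_add_distrib, sub_eq_add_neg, ← Finset.sum_neg_distrib,
    map_pow]
  congr 1
  refine Finset.sum_congr rfl fun i _ => ?_
  simp only [quadTerm, map_neg, map_div₀, map_one, map_pow, map_ofNat]
  ring

omit [Algebra ℂ K] in
theorem sum_quadTerm_eq_parFrac (x y : ι → K) (a : K) (b c : ι → K) :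
    RatFunc.C a + ∑ i, RatFunc.C (b i) * (RatFunc.C (y i) / (2 * ell x i)) +
        ∑ i, RatFunc.C (c i) * quadTerm x y i =
      parFrac x a (fun i => b i * y i / 2 + c i / 2) (fun i => c i * y i ^ 2 / 4) := by
  rw [parFrac, add_assoc, add_assoc, ← Finset.sum_add_distrib, ← Finset.sum_add_distrib]
  congr 1
  refine Finset.sum_congr rfl fun i _ => ?_
  simp only [quadTerm, map_add, map_mul, map_div₀, map_pow, map_ofNat]
  ring

theorem eq_zero_of_twisted_eq [DecidableEq ι] (hx : Function.Injective x) (hy : ∀ i, y i ≠ 0)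
    (hr : r ≠ 0) {a : K} {b c : ι → K} {i₀ : ι} (hc : c i₀ = 0) {f : RatFunc K}
    (hf : twisted x y r (sDeriv K) f =
      RatFunc.C a + ∑ i, RatFunc.C (b i) * (RatFunc.C (y i) / (2 * ell x i)) +
        ∑ i, RatFunc.C (c i) * quadTerm x y i) :
    a = 0 ∧ b = 0 ∧ c = 0 := by
  have : CharZero K := charZero_of_injective_algebraMap (algebraMap ℂ K).injective
  rw [twisted_sDeriv_apply, sub_sum_quadTerm, sum_quadTerm_eq_parFrac] at hf
  obtain ⟨ha, hb, hc'⟩ := eq_zero_of_twisted_eq_parFrac hx (i₀ := i₀) (pow_ne_zero 2 hr)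
    (fun i => by simpa using hy i) (by simp [hc]) hf
  have hc0 : c = 0 := by
    funext i
    simpa [hy i] using congrFun hc' i
  refine ⟨ha, ?_, hc0⟩
  funext i
  simpa [hy i, hc0] using congrFun hb i

end Formulas

/-! ### The action of differential operators on twisted functions -/

section RatDeriv

variable {σ : Type}

/-- The variable `x_s` as a rational function. -/
def ratVar (s : σ) : RatFun σ := algebraMap (MvPolynomial σ ℂ) (RatFun σ) (MvPolynomial.X s)

theorem ratVar_injective : Function.Injective (ratVar (σ := σ)) := fun _ _ h =>
  MvPolynomial.X_injective (IsFractionRing.injective (MvPolynomial σ ℂ) (RatFun σ) h)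

theorem ratVar_ne_zero (s : σ) : ratVar s ≠ 0 :=
  (map_ne_zero_iff _ (IsFractionRing.injective (MvPolynomial σ ℂ) (RatFun σ))).mpr
    (MvPolynomial.X_ne_zero (R := ℂ) s)

theorem ratDeriv_ratVar_self (s : σ) : ratDeriv s (ratVar s) = 1 := by
  rw [ratVar, ratDeriv_algebraMap, MvPolynomial.pderiv_X_self, map_one]

theorem ratDeriv_ratVar_of_ne {s t : σ} (h : s ≠ t) : ratDeriv s (ratVar t) = 0 := by
  rw [ratVar, ratDeriv_algebraMap, MvPolynomial.pderiv_X_of_ne h.symm, map_zero]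

theorem ratDeriv_comm (s t : σ) (f : RatFun σ) :
    ratDeriv s (ratDeriv t f) = ratDeriv t (ratDeriv s f) := by
  have hp : ⁅MvPolynomial.pderiv (R := ℂ) s, MvPolynomial.pderiv (R := ℂ) t⁆ = 0 := by
    classical
    refine MvPolynomial.derivation_ext fun i => ?_
    rw [Derivation.commutator_apply, MvPolynomial.pderiv_X, MvPolynomial.pderiv_X,
      Derivation.zero_apply, Pi.single_apply, Pi.single_apply]
    split_ifs <;> simp
  have h : ⁅ratDeriv s, ratDeriv t⁆ = 0 := by
    refine deriv_eq_of_algebraMap (A := MvPolynomial σ ℂ) fun p => ?_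
    rw [Derivation.commutator_apply, ratDeriv_algebraMap, ratDeriv_algebraMap,
      ratDeriv_algebraMap, ratDeriv_algebraMap, ← map_sub, ← Derivation.commutator_apply, hp,
      Derivation.zero_apply, Derivation.zero_apply, map_zero]
  rw [← sub_eq_zero, ← Derivation.commutator_apply, h, Derivation.zero_apply]

end RatDeriv

section DiffOp

variable {σ : Type}

/-- The ring `K⟨∂⟩` is generated by `K` and the derivations. -/
theorem DiffOp.induction {p : DiffOp σ → Prop} (coeff : ∀ a, p (DiffOp.coeff σ a))
    (d : ∀ s, p (DiffOp.d s)) (add : ∀ P Q, p P → p Q → p (P + Q))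
    (mul : ∀ P Q, p P → p Q → p (P * Q)) (P : DiffOp σ) : p P := by
  obtain ⟨F, rfl⟩ : ∃ F, DiffOp.mk σ F = P := RingQuot.mkAlgHom_surjective ℂ _ P
  induction F using FreeAlgebra.induction with
  | grade0 c =>
    rw [AlgHom.commutes, ← AlgHom.commutes (DiffOp.coeff σ)]
    exact coeff _
  | grade1 v =>
    rcases v with a | s
    · exact coeff a
    · exact d s
  | mul F G hF hG => rw [map_mul]; exact mul _ _ hF hG
  | add F G hF hG => rw [map_add]; exact add _ _ hF hG

theorem DiffOp.smul_eq (a : RatFun σ) (P : DiffOp σ) : a • P = DiffOp.coeff σ a * P := rfl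

theorem weylToDiffOp_x (s : σ) :
    weylToDiffOp σ (Weyl.x s) = DiffOp.coeff σ (ratVar s) := by
  rw [weylToDiffOp, Weyl.x, Weyl.mk]
  erw [RingQuot.liftAlgHom_mkAlgHom_apply]
  simp [ratVar]

theorem weylToDiffOp_d (s : σ) : weylToDiffOp σ (Weyl.d s) = DiffOp.d s := by
  rw [weylToDiffOp, Weyl.d, Weyl.mk]
  erw [RingQuot.liftAlgHom_mkAlgHom_apply]
  simp

theorem extendIdeal_span_le_iff {S : Set (Weyl σ)} {I : Ideal (DiffOp σ)} :
    extendIdeal (Ideal.span S) ≤ I ↔ ∀ P ∈ S, weylToDiffOp σ P ∈ I := by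
  constructor
  · exact fun h P hP => h (Ideal.subset_span ⟨P, Ideal.subset_span hP, rfl⟩)
  · intro h
    refine Ideal.span_le.mpr ?_
    rintro _ ⟨P, hP, rfl⟩
    have : Ideal.span S ≤ I.comap (weylToDiffOp σ) := Ideal.span_le.mpr h
    exact this hP

/-- The action of `K⟨∂⟩` on `K(s)` for which `∂_s` acts as a twisted derivative. -/
def action {ι : Type*} [Fintype ι] (x y : ι → RatFun σ) (r : RatFun σ) :
    DiffOp σ →ₐ[ℂ] Module.End ℂ (RatFunc (RatFun σ)) :=
  RingQuot.liftAlgHom ℂ (s := DiffOpRel σ)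
    ⟨FreeAlgebra.lift ℂ (Sum.elim (fun a => LinearMap.mulLeft ℂ (RatFunc.C a))
      (fun s => twisted x y r (coeffDeriv (ratDeriv s)))), by
      intro P Q h
      cases h with
      | scalar c =>
        ext f
        simp only [FreeAlgebra.lift_ι_apply, Sum.elim_inl, LinearMap.mulLeft_apply,
          AlgHom.commutes, Module.algebraMap_end_apply]
        rw [Algebra.smul_def, IsScalarTower.algebraMap_apply ℂ (RatFun σ) (RatFunc (RatFun σ)) c,
          RatFunc.algebraMap_eq_C]
      | add a b => ext f; simp [add_mul]
      | mul a b => ext f; simp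
      | d_comm s t =>
        ext f
        simp only [map_mul, FreeAlgebra.lift_ι_apply, Sum.elim_inr, Module.End.mul_apply]
        exact twisted_comm x y r (coeffDeriv_comm (ratDeriv_comm s t)) f
      | leibniz s a =>
        ext f
        simp [twisted_mul, coeffDeriv_C]⟩

variable {ι : Type*} [Fintype ι] (x y : ι → RatFun σ) (r : RatFun σ)

theorem action_coeff (a : RatFun σ) (f : RatFunc (RatFun σ)) :
    action x y r (DiffOp.coeff σ a) f = RatFunc.C a * f := by
  change action x y r (RingQuot.mkAlgHom ℂ (DiffOpRel σ) _) f = _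
  rw [action]
  erw [RingQuot.liftAlgHom_mkAlgHom_apply]
  simp

theorem action_d (s : σ) (f : RatFunc (RatFun σ)) :
    action x y r (DiffOp.d s) f = twisted x y r (coeffDeriv (ratDeriv s)) f := by
  change action x y r (RingQuot.mkAlgHom ℂ (DiffOpRel σ) _) f = _
  rw [action]
  erw [RingQuot.liftAlgHom_mkAlgHom_apply]
  simp

theorem action_d_one (s : σ) :
    action x y r (DiffOp.d s) 1 = logDer x y r (coeffDeriv (ratDeriv s)) := by
  rw [action_d, twisted_apply, Derivation.map_one_eq_zero, zero_add, mul_one]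

theorem twisted_sDeriv_C_mul (a : RatFun σ) (f : RatFunc (RatFun σ)) :
    twisted x y r (sDeriv _) (RatFunc.C a * f) = RatFunc.C a * twisted x y r (sDeriv _) f := by
  rw [twisted_mul, sDeriv_C, zero_mul, add_zero]

theorem action_twisted_sDeriv (P : DiffOp σ) (f : RatFunc (RatFun σ)) :
    action x y r P (twisted x y r (sDeriv _) f) = twisted x y r (sDeriv _) (action x y r P f) := by
  induction P using DiffOp.induction generalizing f with
  | coeff a => rw [action_coeff, action_coeff, twisted_sDeriv_C_mul]
  | d s =>
    rw [action_d, action_d]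
    exact twisted_comm x y r (coeffDeriv_sDeriv _) f
  | add P Q hP hQ => simp only [map_add, LinearMap.add_apply, hP, hQ]
  | mul P Q hP hQ => simp only [map_mul, Module.End.mul_apply, hP, hQ]

/-- The left ideal of all `P` in `K⟨∂⟩` that annihilate the class of `1` in the cokernel of the
twisted `d/ds`. -/
def annihilator : Ideal (DiffOp σ) where
  carrier := {P | ∃ f, twisted x y r (sDeriv _) f = action x y r P 1}
  add_mem' := by
    rintro P Q ⟨f, hf⟩ ⟨g, hg⟩
    exact ⟨f + g, by rw [map_add, hf, hg, map_add, LinearMap.add_apply]⟩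
  zero_mem' := ⟨0, by simp⟩
  smul_mem' := by
    rintro P Q ⟨f, hf⟩
    exact ⟨action x y r P f, by
      rw [← action_twisted_sDeriv, hf, smul_eq_mul, map_mul, Module.End.mul_apply]⟩

theorem mem_annihilator {P : DiffOp σ} :
    P ∈ annihilator x y r ↔ ∃ f, twisted x y r (sDeriv _) f = action x y r P 1 := Iff.rfl

end DiffOp

/-! ### The Fisher–Bingham operators in the twisted cohomology -/

section Model

variable (n : ℕ)

/-- The variable `x_ii` as a rational function. -/
def xVar (i : Fin (n + 1)) : RatFun (Var n) := ratVar (Var.x i i le_rfl)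

/-- The variable `y_i` as a rational function. -/
def yVar (i : Fin (n + 1)) : RatFun (Var n) := ratVar (Var.y i)

/-- The variable `r` as a rational function. -/
def rVar : RatFun (Var n) := ratVar Var.r

theorem xVar_injective : Function.Injective (xVar n) := fun i j h => by
  have := ratVar_injective h
  injection this

/-- The action of `K⟨∂⟩` on `K(s)` attached to the Fisher–Bingham system. -/
abbrev fbAction : DiffOp (Var n) →ₐ[ℂ] Module.End ℂ (RatFunc (RatFun (Var n))) :=
  action (xVar n) (yVar n) (rVar n)

variable {n}

theorem fbAction_d_xx_one (k : Fin (n + 1)) :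
    fbAction n (DiffOp.d (Var.x k k le_rfl)) 1 = quadTerm (xVar n) (yVar n) k := by
  rw [action_d_one]
  refine logDer_x (ratDeriv_ratVar_self _) (fun i hi => ratDeriv_ratVar_of_ne ?_)
    (fun i => ratDeriv_ratVar_of_ne ?_) (ratDeriv_ratVar_of_ne ?_)
  · simpa using hi.symm
  · simp
  · simp

theorem fbAction_d_x_one_of_lt {i j : Fin (n + 1)} (h : i < j) :
    fbAction n (DiffOp.d (Var.x i j h.le)) 1 = 0 := by
  rw [action_d_one]
  refine logDer_eq_zero (fun k => ratDeriv_ratVar_of_ne ?_)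
    (fun i => ratDeriv_ratVar_of_ne ?_) (ratDeriv_ratVar_of_ne ?_)
  · intro e
    injection e with e1 e2
    exact h.ne (e1.trans e2.symm)
  · simp
  · simp

theorem fbAction_d_r_one :
    fbAction n (DiffOp.d Var.r) 1 =
      2 * RatFunc.X * RatFunc.C (rVar n) + 1 / RatFunc.C (rVar n) := by
  rw [action_d_one]
  refine logDer_r (fun k => ratDeriv_ratVar_of_ne ?_)
    (fun i => ratDeriv_ratVar_of_ne ?_) (ratDeriv_ratVar_self _) <;> simp

theorem logDer_dy (k : Fin (n + 1)) :
    logDer (xVar n) (yVar n) (rVar n) (coeffDeriv (ratDeriv (Var.y k))) =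
      RatFunc.C (yVar n k) / (2 * ell (xVar n) k) := by
  refine logDer_y (fun i => ratDeriv_ratVar_of_ne ?_) (ratDeriv_ratVar_self _)
    (fun i hi => ratDeriv_ratVar_of_ne ?_) (ratDeriv_ratVar_of_ne ?_)
  · simp
  · simpa using hi.symm
  · simp

theorem fbAction_d_y_one (k : Fin (n + 1)) :
    fbAction n (DiffOp.d (Var.y k)) 1 = RatFunc.C (yVar n k) / (2 * ell (xVar n) k) := by
  rw [action_d_one, logDer_dy]

theorem fbAction_d_y_y_one {j k : Fin (n + 1)} (h : j ≠ k) :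
    fbAction n (DiffOp.d (Var.y j)) (fbAction n (DiffOp.d (Var.y k)) 1) =
      RatFunc.C (yVar n j) / (2 * ell (xVar n) j) *
        (RatFunc.C (yVar n k) / (2 * ell (xVar n) k)) := by
  have hx : ratDeriv (Var.y j) (xVar n k) = 0 := ratDeriv_ratVar_of_ne (by simp)
  have hy : ratDeriv (Var.y j) (yVar n k) = 0 := ratDeriv_ratVar_of_ne (by simpa using h)
  rw [fbAction_d_y_one, action_d, twisted_apply, logDer_dy, coeffDeriv_div_ell hx, hy, map_zero,
    zero_div, zero_add]

theorem fbAction_d_y_d_y_one (k : Fin (n + 1)) :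
    fbAction n (DiffOp.d (Var.y k)) (fbAction n (DiffOp.d (Var.y k)) 1) =
      quadTerm (xVar n) (yVar n) k := by
  have hx : ratDeriv (Var.y k) (xVar n k) = 0 := ratDeriv_ratVar_of_ne (by simp)
  have hy : ratDeriv (Var.y k) (yVar n k) = 1 := ratDeriv_ratVar_self _
  rw [fbAction_d_y_one, action_d, twisted_apply, logDer_dy, coeffDeriv_div_ell hx, hy,
    one_div_add_mul_self]

/-- The operators `A_i`, `C_ij` and `∂_ij` annihilate `1`, and `B` and `E` map `1` to the images of
`-1` and `2 s` under the twisted `d/ds`. -/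
theorem extendIdeal_diagonalSystem_le :
    extendIdeal (diagonalSystem n) ≤ annihilator (xVar n) (yVar n) (rVar n) := by
  rw [diagonalSystem, extendIdeal_span_le_iff]
  rintro _ ((((⟨i, rfl⟩ | rfl) | ⟨i, j, hij, rfl⟩) | rfl) | ⟨i, j, hij, rfl⟩) <;>
    rw [mem_annihilator]
  · refine ⟨0, ?_⟩
    simp only [opA, dxx, dy, pow_two, map_sub, map_mul, weylToDiffOp_d, LinearMap.sub_apply,
      Module.End.mul_apply, fbAction_d_y_d_y_one]
    rw [fbAction_d_xx_one, map_zero, sub_self]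
  · refine ⟨-1, ?_⟩
    simp only [opB, rr, dy, pow_two, map_sub, map_sum, map_mul, weylToDiffOp_d, weylToDiffOp_x,
      LinearMap.sub_apply, LinearMap.sum_apply, Module.End.mul_apply, fbAction_d_y_d_y_one,
      action_coeff]
    rw [twisted_sDeriv_neg_one, mul_one, pow_two]
    rfl
  · refine ⟨0, ?_⟩
    simp only [opC, xx, yy, dy, map_sub, map_add, map_mul, map_ofNat, weylToDiffOp_d,
      weylToDiffOp_x, LinearMap.sub_apply, LinearMap.add_apply, Module.End.mul_apply,
      fbAction_d_y_y_one hij.ne, action_coeff, Module.End.ofNat_apply]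
    rw [fbAction_d_y_one, fbAction_d_y_one, map_zero]
    refine (mixed_relation (xVar n) (yVar n) i j).symm.trans ?_
    simp only [nsmul_eq_mul, Nat.cast_ofNat, xVar, yVar, sub_mul, mul_sub, mul_assoc]
  · refine ⟨2 * RatFunc.X, ?_⟩
    simp only [opE, rr, dr, xx, yy, dy, pow_two, map_sub, map_sum, map_mul, map_natCast,
      map_ofNat, weylToDiffOp_d, weylToDiffOp_x, LinearMap.sub_apply, LinearMap.sum_apply,
      Module.End.mul_apply, fbAction_d_y_d_y_one, action_coeff, Module.End.ofNat_apply,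
      Module.End.natCast_apply]
    simp only [fbAction_d_y_one, fbAction_d_r_one]
    refine (twisted_sDeriv_two_mul_X (xVar n) (yVar n) (ratVar_ne_zero _)).trans ?_
    simp only [Fintype.card_fin, Nat.cast_add, Nat.cast_one, add_sub_cancel_right, nsmul_eq_mul,
      Nat.cast_ofNat, mul_one, Finset.mul_sum, rVar, xVar, yVar]
  · refine ⟨0, ?_⟩
    rw [dxx, weylToDiffOp_d, fbAction_d_x_one_of_lt hij, map_zero]

theorem eq_zero_of_mem_annihilator {g : Unit ⊕ Fin (n + 1) ⊕ Fin n → RatFun (Var n)}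
    (h : ∑ m, g m • stdMonomial n m ∈ annihilator (xVar n) (yVar n) (rVar n)) : g = 0 := by
  obtain ⟨f, hf⟩ := (mem_annihilator _ _ _).mp h
  have hz := eq_zero_of_twisted_eq (y := yVar n) (xVar_injective n)
    (fun i => ratVar_ne_zero (Var.y i)) (ratVar_ne_zero Var.r) (a := g (Sum.inl ())) (b := fun k => g (Sum.inr (Sum.inl k)))
    (c := Fin.cons 0 fun k => g (Sum.inr (Sum.inr k))) (i₀ := 0) rfl (f := f) (hf.trans (by
      simp only [Fintype.sum_sum_type, map_add, map_sum, DiffOp.smul_eq, map_mul,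
        LinearMap.add_apply, LinearMap.sum_apply, Module.End.mul_apply, action_coeff,
        stdMonomial, pow_two, map_one, Module.End.one_apply,
        fbAction_d_y_d_y_one, Finset.univ_unique, Finset.sum_singleton]
      simp only [fbAction_d_y_one]
      rw [Fin.sum_univ_succ (n := n) fun i => RatFunc.C (Fin.cons _ _ i) * _]
      simp [add_assoc]))
  obtain ⟨ha, hb, hc⟩ := hz
  funext m
  rcases m with m | k | k
  · exact ha
  · exact congrFun hb k
  · simpa using congrFun hc k.succ

theorem linearIndependent_stdMonomial :
    LinearIndependent (RatFun (Var n)) fun m =>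
      (Submodule.Quotient.mk (stdMonomial n m) :
        DiffOp (Var n) ⧸ extendIdeal (diagonalSystem n)) := by
  rw [Fintype.linearIndependent_iff]
  intro g hg
  refine congrFun (eq_zero_of_mem_annihilator (extendIdeal_diagonalSystem_le ?_))
  rw [← Submodule.Quotient.mk_eq_zero, ← hg]
  simp only [← Submodule.Quotient.mk_smul]
  exact map_sum (Submodule.mkQ _) _ _

end Model

/-! ### The standard monomials span -/

section Span

section Leibniz

variable {σ : Type} {M : Type*} [AddCommGroup M] [Module (DiffOp σ) M] [Module (RatFun σ) M]
  [IsScalarTower (RatFun σ) (DiffOp σ) M]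

theorem coeff_smul (a : RatFun σ) (m : M) : DiffOp.coeff σ a • m = a • m := by
  rw [← one_smul (DiffOp σ) m, ← smul_assoc, ← smul_assoc, DiffOp.smul_eq, mul_one, smul_eq_mul,
    mul_one]

theorem d_smul_smul (s : σ) (a : RatFun σ) (m : M) :
    DiffOp.d s • a • m = a • DiffOp.d s • m + ratDeriv s a • m := by
  rw [← coeff_smul a m, ← mul_smul, DiffOp.d_mul_coeff, add_smul, mul_smul, coeff_smul, coeff_smul]

omit [Module (RatFun σ) M] [IsScalarTower (RatFun σ) (DiffOp σ) M] in
theorem d_smul_comm (s t : σ) (m : M) :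
    (DiffOp.d s : DiffOp σ) • (DiffOp.d t : DiffOp σ) • m = DiffOp.d t • DiffOp.d s • m := by
  rw [← mul_smul, DiffOp.d_comm, mul_smul]

theorem d_smul_mem_span {v : Set M} (s : σ)
    (h : ∀ m ∈ v, (DiffOp.d s : DiffOp σ) • m ∈ Submodule.span (RatFun σ) v) {m : M}
    (hm : m ∈ Submodule.span (RatFun σ) v) :
    (DiffOp.d s : DiffOp σ) • m ∈ Submodule.span (RatFun σ) v := by
  induction hm using Submodule.span_induction with
  | mem m hm => exact h m hm
  | zero => rw [smul_zero]; exact zero_mem _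
  | add m m' _ _ hm hm' => rw [smul_add]; exact add_mem hm hm'
  | smul a m hm hm' =>
    rw [d_smul_smul]
    exact add_mem (Submodule.smul_mem _ _ hm') (Submodule.smul_mem _ _ hm)

theorem smul_mem_of_d_smul_mem {S : Submodule (RatFun σ) M}
    (h : ∀ s, ∀ m ∈ S, (DiffOp.d s : DiffOp σ) • m ∈ S) (P : DiffOp σ) {m : M} (hm : m ∈ S) :
    P • m ∈ S := by
  induction P using DiffOp.induction generalizing m with
  | coeff a => rw [coeff_smul]; exact S.smul_mem a hm
  | d s => exact h s m hm
  | add P Q hP hQ => rw [add_smul]; exact add_mem (hP hm) (hQ hm)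
  | mul P Q hP hQ => rw [mul_smul]; exact hP (hQ hm)

end Leibniz

variable {n : ℕ} {M : Type*} [AddCommGroup M] [Module (DiffOp (Var n)) M]
  [Module (RatFun (Var n)) M] [IsScalarTower (RatFun (Var n)) (DiffOp (Var n)) M]

local notation:max "δ" k:max => (DiffOp.d (Var.y k) : DiffOp (Var _))

variable (n) in
/-- The vector `e` is a solution of the Fisher–Bingham system. -/
def IsSolution (e : M) : Prop :=
  ∀ P ∈ diagonalSystem n, weylToDiffOp (Var n) P • e = 0

variable {e : M}

omit [Module (RatFun (Var n)) M] [IsScalarTower (RatFun (Var n)) (DiffOp (Var n)) M] in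
theorem IsSolution.d_xx (h : IsSolution n e) (i : Fin (n + 1)) :
    (DiffOp.d (Var.x i i le_rfl) : DiffOp (Var n)) • e = δ i • δ i • e := by
  have h1 := h (opA n i) (Ideal.subset_span (Or.inl (Or.inl (Or.inl (Or.inl ⟨i, rfl⟩)))))
  simpa only [opA, dxx, dy, pow_two, map_sub, map_mul, weylToDiffOp_d, sub_smul, mul_smul,
    sub_eq_zero] using h1

omit [Module (RatFun (Var n)) M] [IsScalarTower (RatFun (Var n)) (DiffOp (Var n)) M] in
theorem IsSolution.d_x_of_lt (h : IsSolution n e) {i j : Fin (n + 1)} (hij : i < j) :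
    (DiffOp.d (Var.x i j hij.le) : DiffOp (Var n)) • e = 0 := by
  have h1 := h (dxx n i j hij.le) (Ideal.subset_span (Or.inr ⟨i, j, hij, rfl⟩))
  simpa only [dxx, weylToDiffOp_d] using h1

theorem IsSolution.sum_d_y (h : IsSolution n e) :
    ∑ i : Fin (n + 1), δ i • δ i • e = rVar n ^ 2 • e := by
  have h1 := h (opB n) (Ideal.subset_span (Or.inl (Or.inl (Or.inl (Or.inr rfl)))))
  simpa only [opB, rr, dy, rVar, pow_two, map_sub, map_mul, map_sum, weylToDiffOp_d, weylToDiffOp_x,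
    sub_smul, Finset.sum_smul, mul_smul, sub_eq_zero, coeff_smul] using h1

theorem IsSolution.d_y_d_y (h : IsSolution n e) {i j : Fin (n + 1)} (hij : i ≠ j) :
    (2 * (xVar n i - xVar n j)) • δ i • δ j • e = yVar n j • δ i • e - yVar n i • δ j • e := by
  wlog hlt : i < j generalizing i j
  · have h1 := this hij.symm (lt_of_le_of_ne (not_lt.mp hlt) hij.symm)
    rw [d_smul_comm] at h1
    rw [← neg_sub (yVar n i • _), ← h1, ← neg_smul]
    congr 1
    ring
  have h1 := h (opC n i j)
    (Ideal.subset_span (Or.inl (Or.inl (Or.inr ⟨i, j, hlt, rfl⟩))))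
  have h2 : weylToDiffOp (Var n) (opC n i j) • e = (2 * (xVar n i - xVar n j)) • δ i • δ j • e +
      yVar n i • δ j • e - yVar n j • δ i • e := by
    have e2 : (2 : DiffOp (Var n)) = DiffOp.coeff _ 2 := by rw [map_ofNat]
    simp only [opC, xx, yy, dy, map_sub, map_add, map_mul, map_ofNat, weylToDiffOp_d,
      weylToDiffOp_x, sub_smul, add_smul, mul_smul]
    simp only [e2, coeff_smul, smul_sub, xVar, yVar]
  rw [h2, add_sub_assoc, add_eq_zero_iff_eq_neg, neg_sub] at h1
  exact h1

theorem IsSolution.d_r (h : IsSolution n e) :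
    rVar n • (DiffOp.d Var.r : DiffOp (Var n)) • e =
      (2 : RatFun (Var n)) • ∑ i : Fin (n + 1), xVar n i • δ i • δ i • e +
        ∑ i : Fin (n + 1), yVar n i • δ i • e + (n : RatFun (Var n)) • e := by
  have h1 := h (opE n) (Ideal.subset_span (Or.inl (Or.inr rfl)))
  have e2 : (2 : DiffOp (Var n)) = DiffOp.coeff _ 2 := by rw [map_ofNat]
  have en : (n : DiffOp (Var n)) = DiffOp.coeff _ (n : RatFun (Var n)) := by rw [map_natCast]
  simp only [opE, rr, dr, xx, yy, dy, pow_two, map_sub, map_mul, map_sum, map_ofNat, map_natCast,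
    weylToDiffOp_d, weylToDiffOp_x, sub_smul, Finset.sum_smul, mul_smul] at h1
  simp only [e2, en, coeff_smul] at h1
  rw [sub_sub, sub_sub, sub_eq_zero] at h1
  rw [add_assoc]
  exact h1

variable (n) in
/-- The span of the standard monomials applied to `e`. -/
def stdSpan (e : M) : Submodule (RatFun (Var n)) M :=
  Submodule.span _ (Set.range fun m => stdMonomial n m • e)

omit [IsScalarTower (RatFun (Var n)) (DiffOp (Var n)) M] in
theorem mem_stdSpan (e : M) : e ∈ stdSpan n e := by
  have h := Submodule.subset_span (R := RatFun (Var n)) (Set.mem_range_self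
    (f := fun m => stdMonomial n m • e) (Sum.inl ()))
  rwa [stdMonomial, one_smul] at h

omit [IsScalarTower (RatFun (Var n)) (DiffOp (Var n)) M] in
theorem d_y_mem_stdSpan (e : M) (k : Fin (n + 1)) : δ k • e ∈ stdSpan n e :=
  Submodule.subset_span (Set.mem_range_self (f := fun m => stdMonomial n m • e)
    (Sum.inr (Sum.inl k)))

theorem IsSolution.d_y_sq_mem (h : IsSolution n e) (k : Fin (n + 1)) :
    δ k • δ k • e ∈ stdSpan n e := by
  have hs (k : Fin n) : δ k.succ • δ k.succ • e ∈ stdSpan n e := by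
    have h := Submodule.subset_span (R := RatFun (Var n)) (Set.mem_range_self
      (f := fun m => stdMonomial n m • e) (Sum.inr (Sum.inr k)))
    rwa [stdMonomial, pow_two, mul_smul] at h
  rcases Fin.eq_zero_or_eq_succ k with rfl | ⟨k, rfl⟩
  · have h1 := h.sum_d_y
    rw [Fin.sum_univ_succ, ← eq_sub_iff_add_eq] at h1
    rw [h1]
    exact sub_mem (Submodule.smul_mem _ _ (mem_stdSpan e)) (sum_mem fun k _ => hs k)
  · exact hs k

theorem IsSolution.d_y_d_y_eq (h : IsSolution n e) {i j : Fin (n + 1)} (hij : i ≠ j) :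
    δ i • δ j • e = (2 * (xVar n i - xVar n j))⁻¹ • (yVar n j • δ i • e - yVar n i • δ j • e) := by
  have hx : 2 * (xVar n i - xVar n j) ≠ 0 :=
    mul_ne_zero two_ne_zero (sub_ne_zero.mpr fun e => hij (xVar_injective n e))
  rw [← h.d_y_d_y hij, inv_smul_smul₀ hx]

theorem IsSolution.d_y_d_y_mem (h : IsSolution n e) (i j : Fin (n + 1)) :
    δ i • δ j • e ∈ stdSpan n e := by
  rcases eq_or_ne i j with rfl | hij
  · exact h.d_y_sq_mem i
  · rw [h.d_y_d_y_eq hij]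
    exact Submodule.smul_mem _ _ (sub_mem (Submodule.smul_mem _ _ (d_y_mem_stdSpan e i))
      (Submodule.smul_mem _ _ (d_y_mem_stdSpan e j)))

theorem IsSolution.d_y_d_y_sq_mem_of_ne (h : IsSolution n e) {i j : Fin (n + 1)} (hij : j ≠ i) :
    δ j • δ i • δ i • e ∈ stdSpan n e := by
  have h1 : δ j • δ i • δ i • e = δ i • δ j • δ i • e := d_smul_comm _ _ _
  rw [h1, h.d_y_d_y_eq hij, d_smul_smul, smul_sub, d_smul_smul, d_smul_smul]
  have hj := d_y_mem_stdSpan e j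
  have hi := d_y_mem_stdSpan e i
  refine add_mem (Submodule.smul_mem _ _ (sub_mem (add_mem ?_ ?_) (add_mem ?_ ?_)))
    (Submodule.smul_mem _ _ (sub_mem ?_ ?_)) <;> apply Submodule.smul_mem
  exacts [h.d_y_d_y_mem i j, hj, h.d_y_d_y_mem i i, hi, hj, hi]

theorem IsSolution.d_y_d_y_sq_mem (h : IsSolution n e) (i j : Fin (n + 1)) :
    δ j • δ i • δ i • e ∈ stdSpan n e := by
  rcases eq_or_ne j i with rfl | hij
  · -- the relations `C_ij` do not reduce `∂_j³`; replace `∂_j²` by means of `B`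
    have h1 := h.sum_d_y
    rw [← Finset.add_sum_erase _ _ (Finset.mem_univ j), ← eq_sub_iff_add_eq] at h1
    rw [h1]
    rw [smul_sub, d_smul_smul, Finset.smul_sum]
    refine sub_mem (add_mem (Submodule.smul_mem _ _ (d_y_mem_stdSpan e j))
      (Submodule.smul_mem _ _ (mem_stdSpan e))) (sum_mem fun i hi => ?_)
    exact h.d_y_d_y_sq_mem_of_ne (Finset.ne_of_mem_erase hi).symm
  · exact h.d_y_d_y_sq_mem_of_ne hij

theorem IsSolution.d_y_smul_mem (h : IsSolution n e) (j : Fin (n + 1)) {m : M}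
    (hm : m ∈ stdSpan n e) : δ j • m ∈ stdSpan n e := by
  refine d_smul_mem_span _ ?_ hm
  rintro _ ⟨k | k | k, rfl⟩
  · change δ j • (1 : DiffOp (Var n)) • e ∈ stdSpan n e
    rw [one_smul]
    exact d_y_mem_stdSpan e j
  · exact h.d_y_d_y_mem j k
  · change δ j • δ k.succ ^ 2 • e ∈ stdSpan n e
    rw [pow_two, mul_smul]
    exact h.d_y_d_y_sq_mem k.succ j

/-- As all derivations commute, the image of a standard monomial under `∂_s` is a polynomial in the
`∂_i` applied to `∂_s e`. -/
theorem IsSolution.d_smul_mem_of (h : IsSolution n e) {s : Var n}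
    (hs : (DiffOp.d s : DiffOp (Var n)) • e ∈ stdSpan n e) {m : M}
    (hm : m ∈ stdSpan n e) : (DiffOp.d s : DiffOp (Var n)) • m ∈ stdSpan n e := by
  refine d_smul_mem_span _ ?_ hm
  rintro _ ⟨k | k | k, rfl⟩
  · change DiffOp.d s • (1 : DiffOp (Var n)) • e ∈ stdSpan n e
    rwa [one_smul]
  · change DiffOp.d s • δ k • e ∈ stdSpan n e
    rw [d_smul_comm]
    exact h.d_y_smul_mem k hs
  · change DiffOp.d s • δ k.succ ^ 2 • e ∈ stdSpan n e
    rw [pow_two, mul_smul, d_smul_comm, d_smul_comm s]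
    exact h.d_y_smul_mem _ (h.d_y_smul_mem _ hs)

theorem IsSolution.d_smul_mem (h : IsSolution n e) (s : Var n) {m : M}
    (hm : m ∈ stdSpan n e) : (DiffOp.d s : DiffOp (Var n)) • m ∈ stdSpan n e := by
  cases s with
  | x i j hij =>
    refine h.d_smul_mem_of ?_ hm
    rcases hij.eq_or_lt with rfl | hlt
    · rw [h.d_xx i]
      exact h.d_y_sq_mem i
    · rw [h.d_x_of_lt hlt]
      exact zero_mem _
  | y k => exact h.d_y_smul_mem k hm
  | r =>
    refine h.d_smul_mem_of ?_ hm
    have hr : rVar n ≠ 0 := ratVar_ne_zero _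
    rw [← one_smul (RatFun (Var n)) (DiffOp.d Var.r • e), ← inv_mul_cancel₀ hr, mul_smul, h.d_r]
    refine Submodule.smul_mem _ _ (add_mem (add_mem (Submodule.smul_mem _ _ (sum_mem fun i _ => ?_))
      (sum_mem fun i _ => ?_)) (Submodule.smul_mem _ _ (mem_stdSpan e)))
    · exact Submodule.smul_mem _ _ (h.d_y_sq_mem i)
    · exact Submodule.smul_mem _ _ (d_y_mem_stdSpan e i)

theorem IsSolution.smul_mem (h : IsSolution n e) (P : DiffOp (Var n)) :
    P • e ∈ stdSpan n e :=
  smul_mem_of_d_smul_mem (fun s _ hm => h.d_smul_mem s hm) P (mem_stdSpan e)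

end Span

theorem span_stdMonomial (n : ℕ) :
    ⊤ ≤ Submodule.span (RatFun (Var n)) (Set.range fun m =>
      (Submodule.Quotient.mk (stdMonomial n m) :
        DiffOp (Var n) ⧸ extendIdeal (diagonalSystem n))) := by
  have mk_eq (P : DiffOp (Var n)) :
      (Submodule.Quotient.mk P : DiffOp (Var n) ⧸ extendIdeal (diagonalSystem n)) =
        P • Submodule.Quotient.mk 1 := by
    rw [← Submodule.Quotient.mk_smul, smul_eq_mul, mul_one]
  have h : IsSolution n (Submodule.Quotient.mk 1 :
      DiffOp (Var n) ⧸ extendIdeal (diagonalSystem n)) := by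
    intro P hP
    rw [← mk_eq, Submodule.Quotient.mk_eq_zero]
    exact Ideal.subset_span ⟨P, hP, rfl⟩
  rintro q -
  obtain ⟨P, rfl⟩ := Submodule.Quotient.mk_surjective _ q
  have hP := h.smul_mem P
  rw [stdSpan, ← mk_eq] at hP
  simpa only [← mk_eq] using hP

end

end FisherBingham

theorem theorem2 (n : ℕ) :
    FisherBingham.holonomicRank (FisherBingham.diagonalSystem n) = ((2 * n + 2 : ℕ) : Cardinal) ∧
    ∃ b : Module.Basis (Unit ⊕ Fin (n + 1) ⊕ Fin n)
        (FisherBingham.RatFun (FisherBingham.Var n))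
        (FisherBingham.DiffOp (FisherBingham.Var n) ⧸
          FisherBingham.extendIdeal (FisherBingham.diagonalSystem n)),
      ∀ m, b m = Submodule.Quotient.mk (FisherBingham.stdMonomial n m) := by
  let b := Module.Basis.mk FisherBingham.linearIndependent_stdMonomial
    (FisherBingham.span_stdMonomial n)
  refine ⟨?_, b, fun m => Module.Basis.mk_apply _ _ m⟩
  rw [FisherBingham.holonomicRank, rank_eq_card_basis b]
  simp only [Fintype.card_sum, Fintype.card_unit, Fintype.card_fin]
  congr 1
  ring
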